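/- Let $X$ be a complex Banach space, $L(X)$ the bounded operators on $X$ with the operator norm, and $\mathcal D(\mathbb R)$ the complex-valued smooth compactly supported functions on $\mathbb R$. A hyperoperator $a$ on $\mathbb R$ is a continuous linear map $\mathcal D(\mathbb R)\to L(X)$, $\phi\mapsto\phi(a)$, such that $(\phi\psi)(a)=\phi(a)\psi(a)$ for all $\phi,\psi$, $\bigcup_\phi \operatorname{Im}\phi(a)$ is dense in $X$, and $\bigcap_\phi\operatorname{Ker}\phi(a)=\{0\}$. Its spectrum $\sigma(a)\subset\mathbb R$ is the support of the distribution $\phi\mapsto\phi(a)$. For $\chi\in\mathcal D(\mathbb R)$ and $\zeta\in\mathbb C\setminus\mathbb R$ put $$\omega^\chi_{\zeta-a}=\frac{d\zeta}{2\pi i}\,g_\zeta(a),\qquad g_\zeta(\xi)=\frac{\chi(\xi)}{\zeta-\xi}.$$ An almost holomorphic extension of $\phi\in\mathcal D(\mathbb R)$ is a function $\tilde\phi\in C_c^\infty(\mathbb C)$ with $\tilde\phi|_{\mathbb R}=\phi$ and $\bar\partial\tilde\phi(\zeta)=\mathcal O(|\operatorname{Im}\zeta|^N)$ for every $N$. Let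 $a$ be a hyperoperator on $\mathbb R$. Then: 1. For every $\chi\in\mathcal D(\mathbb R)$ the form $\omega^\chi_{\zeta-a}$ is holomorphic (in operator norm) for $|\operatorname{Im}\zeta|>0$, and there is an integer $M\ge 0$ such that for every $T$ there is a constant $C$ with $\|\omega^\chi_{\zeta-a}\|\le C|\operatorname{Im}\zeta|^{-M}$ whenever $0<|\operatorname{Im}\zeta|\le T$. 2. If $\chi,\phi\in\mathcal D(\mathbb R)$ and $\operatorname{supp}\phi\subset\{\chi=1\}$, then for every almost holomorphic extension $\tilde\phi$ of $\phi$ $$\phi(a)=\int_{\mathbb C}\omega^\chi_{\zeta-a}\wedge\bar\partial\tilde\phi(\zeta),$$ where the integral is absolutely convergent in $L(X)$. 3. For every $\chi\in\mathcal D(\mathbb R)$ the form $\omega^\chi_{\zeta-a}$ has a holomorphic continuation (in operator norm) to $\mathbb C\setminus\sigma(a)$. Moreover $\mathbb C\setminus\sigma(a)$ is exactly the set of points $p\in\mathbb C$ such that, for every $\chi\in\mathcal D(\mathbb R)$, $\omega^\chi_{\zeta-a}$ is strongly holomorphic at $p$, i.e. there are an open neighbourhood $V$ of $p$ and an $L(X)$-valued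 $(1,0)$-form $F$ on $V$ that agrees with $\omega^\chi_{\zeta-a}$ on $V\setminus\mathbb R$ and such that the form $F x$ is holomorphic in $V$ for every $x\in X$. -/

import Mathlib

open scoped Distributions ContDiff

/-- The space `𝓓(ℝ)` of complex-valued smooth functions on `ℝ` with compact support, with its
canonical LF topology. -/
abbrev TestFn : Type := 𝓓((⊤ : TopologicalSpace.Opens ℝ), ℂ)

/-- The test function `g φ`, where `g` is smooth and `φ` is a test function. -/
noncomputable def smoothMul (g : ℝ → ℂ) (hg : ContDiff ℝ ∞ g) (φ : TestFn) : TestFn where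
  toFun := fun ξ => g ξ * φ ξ
  contDiff' := hg.mul φ.contDiff
  hasCompactSupport' := φ.hasCompactSupport.mul_left
  tsupport_subset' := fun _ _ => trivial

/-- A hyperoperator on `ℝ`: a continuous linear mapping `A : 𝓓(ℝ) → L(X)` (for the operator norm
on `L(X)`) which is multiplicative, and such that the union of the images of the operators `A φ` is
dense and the intersection of their kernels is zero. -/
structure Hyperoperator (X : Type*) [NormedAddCommGroup X] [NormedSpace ℂ X] where
  /-- The underlying `L(X)`-valued distribution; `φ(a)` is the operator `toCLM φ`. -/
  toCLM : TestFn →L[ℂ] (X →L[ℂ] X)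
  map_mul : ∀ φ ψ : TestFn, toCLM (smoothMul φ φ.contDiff ψ) = toCLM φ * toCLM ψ
  dense_range : Dense (⋃ φ : TestFn, Set.range (toCLM φ))
  ker_trivial : ⋂ φ : TestFn, {x : X | toCLM φ x = 0} = {0}

/-- The spectrum of a hyperoperator, i.e. its support as a distribution on `ℝ`. -/
def Hyperoperator.spectrum {X : Type*} [NormedAddCommGroup X] [NormedSpace ℂ X]
    (a : Hyperoperator X) : Set ℝ :=
  Distribution.dsupport a.toCLM

theorem contDiff_inv_sub {ζ : ℂ} (hζ : ζ.im ≠ 0) :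
    ContDiff ℝ ∞ (fun ξ : ℝ => (ζ - (ξ : ℂ))⁻¹) := by
  refine ContDiff.inv (contDiff_const.sub Complex.ofRealCLM.contDiff) fun ξ h => hζ ?_
  have := congrArg Complex.im h
  simpa using this

open Classical in
/-- For `ζ ∉ ℝ`, the test function `ξ ↦ χ(ξ) / (ζ - ξ)`. It is not a smooth function in general
when `ζ` is real; the value is then set to be `0` and it is never used. -/
noncomputable def cauchyCutoff (χ : TestFn) (ζ : ℂ) : TestFn :=
  if hζ : ζ.im ≠ 0 then smoothMul (fun ξ : ℝ => (ζ - (ξ : ℂ))⁻¹) (contDiff_inv_sub hζ) χ else 0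

/-- The pseudoresolvent form `χ(ξ) dζ / (2πi (ζ - ξ))` evaluated at `ξ = a`, for `ζ ∉ ℝ`. It is an
`L(X)`-valued `(1,0)`-form: at each `ζ` a complex linear map `v ↦ dζ(v) • R` from `ℂ` to `L(X)`,
so its operator norm is `‖R‖`. -/
noncomputable def pseudoresolvent {X : Type*} [NormedAddCommGroup X] [NormedSpace ℂ X]
    (a : Hyperoperator X) (χ : TestFn) (ζ : ℂ) : ℂ →L[ℂ] (X →L[ℂ] X) :=
  ContinuousLinearMap.smulRight (1 : ℂ →L[ℂ] ℂ)
    ((2 * (Real.pi : ℂ) * Complex.I)⁻¹ • a.toCLM (cauchyCutoff χ ζ))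

/-- The form `∂̄f` at `ζ`, i.e. the antilinear part `(∂f/∂ζ̄)(ζ) dζ̄` of the real differential. -/
noncomputable def dbar (f : ℂ → ℂ) (ζ : ℂ) : ℂ →L[ℝ] ℂ :=
  (1 / 2 : ℝ) • (fderiv ℝ f ζ +
    Complex.I • (fderiv ℝ f ζ).comp (Complex.I • ContinuousLinearMap.id ℝ ℂ))

/-- The wedge product of an `E`-valued 1-form with a scalar 1-form on `ℂ` (at a point), as a
function of two tangent vectors. -/
noncomputable def wedge {E : Type*} [NormedAddCommGroup E] [NormedSpace ℂ E]
    (α : ℂ →L[ℂ] E) (β : ℂ →L[ℝ] ℂ) (u v : ℂ) : E :=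
  β v • α u - β u • α v

/-- A smooth, compactly supported, almost holomorphic extension `f` of `φ` to `ℂ`: it equals `φ` on
`ℝ` and `∂̄f = O(|Im ζ|^N)` for every `N`. -/
structure IsAlmostHolomorphicExtension (f : ℂ → ℂ) (φ : TestFn) : Prop where
  contDiff : ContDiff ℝ ∞ f
  hasCompactSupport : HasCompactSupport f
  extends_fn : ∀ ξ : ℝ, f (ξ : ℂ) = φ ξ
  dbar_flat : ∀ N : ℕ, ∃ C : ℝ, ∀ ζ : ℂ, ‖dbar f ζ‖ ≤ C * |ζ.im| ^ N

/-- An `L(X)`-valued `(1,0)`-form `α`, given on `ℂ ∖ ℝ`, is strongly holomorphic at `p` if in some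
neighbourhood `V` of `p` there is a form which agrees with `α` on `V ∖ ℝ` and which is holomorphic
when it is applied to any fixed vector of `X`. -/
def StronglyHolomorphicAt {X : Type*} [NormedAddCommGroup X] [NormedSpace ℂ X]
    (α : ℂ → ℂ →L[ℂ] (X →L[ℂ] X)) (p : ℂ) : Prop :=
  ∃ V : Set ℂ, IsOpen V ∧ p ∈ V ∧ ∃ F : ℂ → ℂ →L[ℂ] (X →L[ℂ] X),
    (∀ ζ ∈ V, ζ.im ≠ 0 → F ζ = α ζ) ∧
    ∀ (v : ℂ) (x : X), DifferentiableOn ℂ (fun ζ => F ζ v x) V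

/-! The form is, up to a constant, the Cauchy transform of the distribution `A = a.toCLM` cut off by
`χ`, and everything follows from `A` having finite order `N` on the compact set `supp χ`.

Growth and holomorphy: each derivative in `ξ` of `χ(ξ) / (ζ - ξ)` costs at most one power of the
inverse distance from `ζ` to `supp χ`, so `A` of it is `O(|Im ζ|^{-(N+1)})`. The exact second-order
remainder of `ζ ↦ 1 / (ζ - ξ)` is again a Cauchy quotient, and the same bound makes the transform
complex differentiable in norm off `supp χ`.

Representation: by Cauchy–Pompeiu (`integral_dbar_mul_inv_sub`), the integral of `∂̄f(ζ) χ(ξ) / (ζ -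
ξ)` is `-π φ(ξ)`, and this may be differentiated in `ξ` up to `N` times, because flatness of `∂̄f`
of order `N + 1` absorbs the singularity. `IsOfOrderOn.integral_eq` then moves `A` under the
integral.

Spectrum: where `A` vanishes near a real point, the part of `χ` supported there contributes nothing,
and the transform of the rest is holomorphic at the point. The local extensions agree by density of
the nonreal points. Conversely, suppose the form extends strongly across `p`. A test function `φ`
supported near `p` has an extension `f` supported in the domain of the continuation with `∂̄f` flat
to order `N + 1`. The representation formula expresses `A φ x` as an integral of `∂̄f` against a
holomorphic function, which is zero by integration by parts. So `A` vanishes near `p`. -/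

/-! ### Derivative bounds for cut-off powers of the Cauchy kernel -/

theorem hasDerivAt_inv_sub_ofReal {ζ : ℂ} {ξ : ℝ} (h : ζ ≠ ξ) :
    HasDerivAt (fun ξ : ℝ => (ζ - (ξ : ℂ))⁻¹) ((ζ - (ξ : ℂ))⁻¹ ^ 2) ξ := by
  have h0 : ζ - (ξ : ℂ) ≠ 0 := sub_ne_zero.2 h
  have := ((hasDerivAt_id (ξ : ℂ)).const_sub ζ).fun_inv h0
  convert! this.comp_ofReal using 1
  simp

theorem ne_of_forall_le_norm_sub {K : Set ℝ} {ζ : ℂ} {δ : ℝ} (hδ : 0 < δ)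
    (h : ∀ ξ ∈ K, δ ≤ ‖ζ - (ξ : ℂ)‖) {ξ : ℝ} (hξ : ξ ∈ K) : ζ ≠ ξ := by
  rintro rfl
  have := h ξ hξ
  simp at this
  linarith

/-- A pole at a real `ζ` outside `tsupport h` is harmless, since the product vanishes near it. -/
theorem contDiff_inv_sub_pow_mul {h : ℝ → ℂ} (hh : ContDiff ℝ ∞ h) {ζ : ℂ}
    (hζ : ∀ ξ ∈ tsupport h, ζ ≠ ((ξ : ℝ) : ℂ)) (m : ℕ) :
    ContDiff ℝ ∞ (fun ξ : ℝ => (ζ - (ξ : ℂ))⁻¹ ^ m * h ξ) := by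
  refine contDiff_iff_contDiffAt.2 fun ξ => ?_
  by_cases hξ' : ξ ∈ tsupport h
  swap
  · refine (contDiffAt_const (c := (0 : ℂ))).congr_of_eventuallyEq ?_
    filter_upwards [notMem_tsupport_iff_eventuallyEq.1 hξ'] with x hx
    simp [hx]
  refine ContDiffAt.mul (ContDiffAt.pow (ContDiffAt.inv ?_ ?_) m) hh.contDiffAt
  · exact contDiffAt_const.sub Complex.ofRealCLM.contDiff.contDiffAt
  · exact sub_ne_zero.2 (hζ ξ hξ')

/-- The family of products of a kernel power and a smooth function is stable under differentiation;
this is why the bounds below are proved for all `m` and `h` at once. -/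
theorem deriv_inv_sub_pow_mul {h : ℝ → ℂ} (hh : ContDiff ℝ ∞ h) {ζ : ℂ}
    (hζ : ∀ ξ ∈ tsupport h, ζ ≠ ((ξ : ℝ) : ℂ)) (m : ℕ) :
    deriv (fun ξ : ℝ => (ζ - (ξ : ℂ))⁻¹ ^ m * h ξ) =
      fun ξ : ℝ => (ζ - (ξ : ℂ))⁻¹ ^ m * deriv h ξ + m * ((ζ - (ξ : ℂ))⁻¹ ^ (m + 1) * h ξ) := by
  ext ξ
  by_cases hξ : ξ ∈ tsupport h
  · have h1 := (hasDerivAt_inv_sub_ofReal (hζ ξ hξ)).pow m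
    have h2 : HasDerivAt h (deriv h ξ) ξ :=
      (hh.differentiable (by simp) ξ).hasDerivAt
    refine (h1.mul h2).deriv.trans ?_
    rcases m with _ | m
    · simp
    · simp only [Nat.add_sub_cancel]
      push_cast
      simp only [Pi.pow_apply]
      ring
  · have h0 : h =ᶠ[nhds ξ] 0 := notMem_tsupport_iff_eventuallyEq.1 hξ
    have h1 : (fun ξ : ℝ => (ζ - (ξ : ℂ))⁻¹ ^ m * h ξ) =ᶠ[nhds ξ] fun _ => 0 := by
      filter_upwards [h0] with x hx
      simp [hx]
    rw [h1.deriv_eq, h0.deriv_eq, h0.eq_of_nhds]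
    simp

/-- The derivatives of `ξ ↦ h(ξ) / (ζ - ξ) ^ m` grow at most polynomially in the inverse of the
distance from `ζ` to the support of `h`. -/
theorem exists_norm_iteratedDeriv_inv_sub_pow_mul_le (k : ℕ) : ∀ (m : ℕ) (h : ℝ → ℂ),
    ContDiff ℝ ∞ h → HasCompactSupport h → ∀ T : ℝ, ∃ C : ℝ, 0 ≤ C ∧ ∀ δ : ℝ, 0 < δ → δ ≤ T →
      ∀ ζ : ℂ, (∀ ξ ∈ tsupport h, δ ≤ ‖ζ - (ξ : ℂ)‖) → ∀ ξ : ℝ,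
        ‖iteratedDeriv k (fun ξ : ℝ => (ζ - (ξ : ℂ))⁻¹ ^ m * h ξ) ξ‖ ≤ C * δ⁻¹ ^ (m + k) := by
  induction k with
  | zero =>
    intro m h hh hc T
    obtain ⟨C, hC⟩ := hh.continuous.bounded_above_of_compact_support hc
    have hC0 : 0 ≤ C := (norm_nonneg _).trans (hC 0)
    refine ⟨C, hC0, fun δ hδ _ ζ hζ ξ => ?_⟩
    rw [iteratedDeriv_zero, norm_mul, norm_pow, norm_inv, add_zero, mul_comm C]
    by_cases hξ : ξ ∈ tsupport h
    · have := hζ ξ hξ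
      gcongr
      exact hC ξ
    · rw [image_eq_zero_of_notMem_tsupport hξ]
      simp
      positivity
  | succ k ih =>
    intro m h hh hc T
    have hh' : ContDiff ℝ ∞ (deriv h) := ((contDiff_infty_iff_deriv).1 hh).2
    obtain ⟨C₁, hC₁, h₁⟩ := ih m (deriv h) hh' hc.deriv T
    obtain ⟨C₂, hC₂, h₂⟩ := ih (m + 1) h hh hc T
    refine ⟨C₁ * |T| + m * C₂, by positivity, fun δ hδ hT ζ hζ ξ => ?_⟩
    have hne : ∀ ξ ∈ tsupport h, ζ ≠ ((ξ : ℝ) : ℂ) := fun ξ hξ =>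
      ne_of_forall_le_norm_sub hδ hζ hξ
    have hsub : tsupport (deriv h) ⊆ tsupport h := tsupport_deriv_subset
    have c₁ := contDiff_inv_sub_pow_mul hh' (fun ξ hξ => hne ξ (hsub hξ)) m
    have c₂ := contDiff_inv_sub_pow_mul hh hne (m + 1)
    have e : iteratedDeriv (k + 1) (fun ξ : ℝ => (ζ - (ξ : ℂ))⁻¹ ^ m * h ξ) ξ =
        iteratedDeriv k (fun ξ : ℝ => (ζ - (ξ : ℂ))⁻¹ ^ m * deriv h ξ) ξ +
          m * iteratedDeriv k (fun ξ : ℝ => (ζ - (ξ : ℂ))⁻¹ ^ (m + 1) * h ξ) ξ := by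
      rw [iteratedDeriv_succ', deriv_inv_sub_pow_mul hh hne]
      have := iteratedDeriv_add (n := k) (x := ξ) (c₁.of_le (by exact_mod_cast le_top)).contDiffAt
        ((contDiff_const (c := (m : ℂ))).mul (c₂.of_le (m := k) (by exact_mod_cast le_top))).contDiffAt
      rw [iteratedDeriv_const_mul_field] at this
      exact this
    have b₁ := h₁ δ hδ hT ζ (fun ξ hξ => hζ ξ (hsub hξ)) ξ
    have b₂ := h₂ δ hδ hT ζ hζ ξ
    have hT' : δ ≤ |T| := hT.trans (le_abs_self T)
    -- When the derivative falls on `h` no power of `δ⁻¹` is gained; the missing one is supplied by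
    -- `δ ≤ |T|`.
    have key : δ⁻¹ ^ (m + k) ≤ |T| * δ⁻¹ ^ (m + (k + 1)) := by
      have : δ⁻¹ ^ (m + k) = δ * δ⁻¹ ^ (m + (k + 1)) := by
        rw [← add_assoc, pow_succ']
        field_simp
      rw [this]
      gcongr
    rw [e]
    calc _ ≤ C₁ * δ⁻¹ ^ (m + k) + m * (C₂ * δ⁻¹ ^ (m + 1 + k)) := by
          refine (norm_add_le _ _).trans (add_le_add b₁ ?_)
          rw [norm_mul, Complex.norm_natCast]
          gcongr
      _ ≤ C₁ * (|T| * δ⁻¹ ^ (m + (k + 1))) + m * (C₂ * δ⁻¹ ^ (m + (k + 1))) := by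
          rw [show m + 1 + k = m + (k + 1) by ring]
          gcongr
      _ = _ := by ring

/-! ### Maps of finite order on a compact set -/

/-- A linear map `A` on test functions is of order at most `N` on `K` if, on test functions
supported in `K`, it is controlled by the derivatives of order at most `N`. -/
def IsOfOrderOn {E : Type*} [NormedAddCommGroup E] [NormedSpace ℂ E] (A : TestFn →ₗ[ℂ] E)
    (K : Set ℝ) (N : ℕ) : Prop :=
  ∃ C : ℝ, 0 ≤ C ∧ ∀ ψ : TestFn, tsupport ψ ⊆ K → ∀ B : ℝ,
    (∀ i ≤ N, ∀ ξ, ‖iteratedDeriv i ψ ξ‖ ≤ B) → ‖A ψ‖ ≤ C * B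

theorem IsOfOrderOn.mono {E : Type*} [NormedAddCommGroup E] [NormedSpace ℂ E]
    {A : TestFn →ₗ[ℂ] E} {K K' : Set ℝ} {N N' : ℕ} (h : IsOfOrderOn A K N) (hK : K' ⊆ K)
    (hN : N ≤ N') : IsOfOrderOn A K' N' := by
  obtain ⟨C, hC, h⟩ := h
  exact ⟨C, hC, fun ψ hψ B hB => h ψ (hψ.trans hK) B fun i hi => hB i (hi.trans hN)⟩

/-- A continuous seminorm on the functions supported in `K` is dominated by finitely many of the
defining seminorms; the order is the largest index among them. -/
theorem ContinuousLinearMap.exists_isOfOrderOn {E : Type*} [NormedAddCommGroup E]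
    [NormedSpace ℂ E] (A : TestFn →L[ℂ] E) {K : Set ℝ} (hK : IsCompact K) :
    ∃ N, IsOfOrderOn (A : TestFn →ₗ[ℂ] E) K N := by
  let K' : TopologicalSpace.Compacts ℝ := ⟨K, hK⟩
  let ι : 𝓓_{K'}(ℝ, ℂ) →L[ℂ] TestFn :=
    TestFunction.ofSupportedInCLM ℂ (Ω := ⊤) (K := K') (fun _ _ => trivial)
  let p : Seminorm ℂ 𝓓_{K'}(ℝ, ℂ) := (normSeminorm ℂ E).comp ((A.comp ι : 𝓓_{K'}(ℝ, ℂ) →L[ℂ] E) : 𝓓_{K'}(ℝ, ℂ) →ₗ[ℂ] E)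
  have hp : Continuous p := (A.comp ι).continuous.norm
  obtain ⟨s, C, -, hC⟩ :=
    Seminorm.bound_of_continuous (ContDiffMapSupportedIn.withSeminorms ℂ ℝ ℂ ⊤ K') p hp
  refine ⟨s.sup id, C, C.2, fun ψ hψ B hB => ?_⟩
  have hB0 : 0 ≤ B := (norm_nonneg _).trans (hB 0 (Nat.zero_le _) 0)
  let ψ' : 𝓓_{K'}(ℝ, ℂ) :=
    ContDiffMapSupportedIn.of_support_subset ψ.contDiff (subset_closure.trans hψ)
  have h1 := hC ψ'
  have h2 : p ψ' = ‖A ψ‖ := rfl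
  have h3 : (s.sup (ContDiffMapSupportedIn.seminorm ℂ ℝ ℂ ⊤ K')) ψ' ≤ B := by
    refine Seminorm.finset_sup_apply_le hB0 fun i hi => ?_
    rw [ContDiffMapSupportedIn.seminorm_top_le_iff ℂ hB0]
    intro ξ _
    rw [norm_iteratedFDeriv_eq_norm_iteratedDeriv]
    exact hB i (Finset.le_sup (f := id) hi) ξ
  rw [h2] at h1
  refine h1.trans ?_
  change (C : ℝ) * _ ≤ _
  gcongr

/-! ### Cauchy quotients and their images under maps of finite order -/

open Classical in
/-- The test function `ξ ↦ h(ξ) / (ζ - ξ)`, for `ζ` outside the support of `h`. -/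
noncomputable def cauchyQuotient (h : TestFn) (ζ : ℂ) : TestFn :=
  if hζ : ∀ ξ ∈ tsupport h, ζ ≠ ((ξ : ℝ) : ℂ) then
    { toFun := fun ξ => (ζ - (ξ : ℂ))⁻¹ ^ 1 * h ξ
      contDiff' := contDiff_inv_sub_pow_mul h.contDiff hζ 1
      hasCompactSupport' := h.hasCompactSupport.mul_left
      tsupport_subset' := fun _ _ => trivial }
  else 0

theorem coe_cauchyQuotient {h : TestFn} {ζ : ℂ} (hζ : ∀ ξ ∈ tsupport h, ζ ≠ ((ξ : ℝ) : ℂ)) :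
    ⇑(cauchyQuotient h ζ) = fun ξ : ℝ => (ζ - (ξ : ℂ))⁻¹ ^ 1 * h ξ := by
  rw [cauchyQuotient, dif_pos hζ]
  rfl

theorem cauchyQuotient_apply {h : TestFn} {ζ : ℂ} (hζ : ∀ ξ ∈ tsupport h, ζ ≠ ((ξ : ℝ) : ℂ))
    (ξ : ℝ) : cauchyQuotient h ζ ξ = (ζ - (ξ : ℂ))⁻¹ * h ξ := by
  simp only [coe_cauchyQuotient hζ, pow_one]

theorem ne_ofReal_of_im_ne_zero {ζ : ℂ} (hζ : ζ.im ≠ 0) (ξ : ℝ) : ζ ≠ (ξ : ℂ) := by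
  rintro rfl
  simp at hζ

theorem cauchyCutoff_eq_cauchyQuotient (h : TestFn) {ζ : ℂ} (hζ : ζ.im ≠ 0) :
    cauchyCutoff h ζ = cauchyQuotient h ζ := by
  ext ξ
  rw [cauchyQuotient_apply fun ξ _ => ne_ofReal_of_im_ne_zero hζ ξ, cauchyCutoff, dif_pos hζ]
  rfl

theorem tsupport_cauchyQuotient_subset (h : TestFn) (ζ : ℂ) :
    tsupport (cauchyQuotient h ζ) ⊆ tsupport h := by
  by_cases hζ : ∀ ξ ∈ tsupport h, ζ ≠ ((ξ : ℝ) : ℂ)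
  · rw [coe_cauchyQuotient hζ]
    exact tsupport_mul_subset_right
  · have : ⇑(cauchyQuotient h ζ) = 0 := by
      rw [cauchyQuotient, dif_neg hζ]
      rfl
    rw [this]
    simp

section LinearMap

variable {E : Type*} [NormedAddCommGroup E] [NormedSpace ℂ E] {A : TestFn →ₗ[ℂ] E}

theorem IsOfOrderOn.exists_norm_cauchyQuotient_le {h : TestFn} {N : ℕ}
    (hA : IsOfOrderOn A (tsupport h) N) (T : ℝ) :
    ∃ C : ℝ, 0 ≤ C ∧ ∀ δ : ℝ, 0 < δ → δ ≤ T → ∀ ζ : ℂ,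
      (∀ ξ ∈ tsupport h, δ ≤ ‖ζ - ((ξ : ℝ) : ℂ)‖) →
        ‖A (cauchyQuotient h ζ)‖ ≤ C * δ⁻¹ ^ (N + 1) := by
  obtain ⟨C₀, hC₀, hA⟩ := hA
  choose C hC hb using fun k => exists_norm_iteratedDeriv_inv_sub_pow_mul_le k 1 h h.contDiff
    h.hasCompactSupport T
  refine ⟨C₀ * ∑ k ∈ Finset.range (N + 1), C k * |T| ^ (N - k),
    mul_nonneg hC₀ (Finset.sum_nonneg fun k _ => mul_nonneg (hC k) (by positivity)),
    fun δ hδ hδT ζ hζ => ?_⟩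
  rw [mul_assoc]
  refine hA _ (tsupport_cauchyQuotient_subset h ζ) _ fun i hi ξ => ?_
  have hne : ∀ ξ ∈ tsupport h, ζ ≠ ((ξ : ℝ) : ℂ) := fun ξ hξ =>
    ne_of_forall_le_norm_sub hδ hζ hξ
  rw [coe_cauchyQuotient hne]
  refine (hb i δ hδ hδT ζ hζ ξ).trans ?_
  have hT' : δ ≤ |T| := hδT.trans (le_abs_self T)
  -- Derivatives of order below `N` are less singular; `δ ≤ |T|` brings them all to the exponent `N
  -- + 1`.
  have key : δ⁻¹ ^ (1 + i) ≤ |T| ^ (N - i) * δ⁻¹ ^ (N + 1) := by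
    have : δ⁻¹ ^ (1 + i) = δ ^ (N - i) * δ⁻¹ ^ (N + 1) := by
      rw [show N + 1 = (N - i) + (1 + i) by omega, pow_add _ (N - i), ← mul_assoc, ← mul_pow,
        mul_inv_cancel₀ hδ.ne', one_pow, one_mul]
    rw [this]
    gcongr
  have hi' : i ∈ Finset.range (N + 1) := Finset.mem_range.2 (by omega)
  have hle : C i * |T| ^ (N - i) ≤ ∑ k ∈ Finset.range (N + 1), C k * |T| ^ (N - k) :=
    Finset.single_le_sum (f := fun k => C k * |T| ^ (N - k))
      (fun k _ => mul_nonneg (hC k) (by positivity)) hi'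
  calc C i * δ⁻¹ ^ (1 + i) ≤ C i * (|T| ^ (N - i) * δ⁻¹ ^ (N + 1)) := by
        gcongr
        exact hC i
    _ = (C i * |T| ^ (N - i)) * δ⁻¹ ^ (N + 1) := by ring
    _ ≤ _ := by gcongr

theorem IsOfOrderOn.exists_norm_cauchyCutoff_le {h : TestFn} {N : ℕ}
    (hA : IsOfOrderOn A (tsupport h) N) (T : ℝ) :
    ∃ C : ℝ, 0 ≤ C ∧ ∀ ζ : ℂ, ζ.im ≠ 0 → |ζ.im| ≤ T →
        ‖A (cauchyCutoff h ζ)‖ ≤ C * |ζ.im|⁻¹ ^ (N + 1) := by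
  obtain ⟨C, hC, h⟩ := hA.exists_norm_cauchyQuotient_le T
  refine ⟨C, hC, fun ζ hζ hT => ?_⟩
  rw [cauchyCutoff_eq_cauchyQuotient _ hζ]
  refine h _ (abs_pos.2 hζ) hT ζ fun ξ _ => ?_
  simpa using Complex.abs_im_le_norm (ζ - ξ)

/-- The first-order Taylor remainder of the Cauchy kernel in `ζ` is exactly a quadratic factor times
another cut-off kernel, so no limit has to be taken in the topology of test functions. -/
theorem cauchyQuotient_sub {h : TestFn} {ζ ζ₀ : ℂ} (hζ : ∀ ξ ∈ tsupport h, ζ ≠ ((ξ : ℝ) : ℂ))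
    (hζ₀ : ∀ ξ ∈ tsupport h, ζ₀ ≠ ((ξ : ℝ) : ℂ)) :
    cauchyQuotient h ζ - cauchyQuotient h ζ₀ +
        (ζ - ζ₀) • cauchyQuotient (cauchyQuotient h ζ₀) ζ₀ =
      (ζ - ζ₀) ^ 2 • cauchyQuotient (cauchyQuotient (cauchyQuotient h ζ₀) ζ₀) ζ := by
  have s₁ := tsupport_cauchyQuotient_subset h ζ₀
  have s₂ := (tsupport_cauchyQuotient_subset (cauchyQuotient h ζ₀) ζ₀).trans s₁
  ext ξ
  change cauchyQuotient h ζ ξ - cauchyQuotient h ζ₀ ξ +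
    (ζ - ζ₀) * cauchyQuotient (cauchyQuotient h ζ₀) ζ₀ ξ =
      (ζ - ζ₀) ^ 2 * cauchyQuotient (cauchyQuotient (cauchyQuotient h ζ₀) ζ₀) ζ ξ
  rw [cauchyQuotient_apply fun ξ hξ => hζ ξ (s₂ hξ), cauchyQuotient_apply fun ξ hξ => hζ₀ ξ (s₁ hξ),
    cauchyQuotient_apply hζ, cauchyQuotient_apply hζ₀]
  by_cases hξ : ξ ∈ tsupport h
  · have h₁ := sub_ne_zero.2 (hζ ξ hξ)
    have h₂ := sub_ne_zero.2 (hζ₀ ξ hξ)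
    field_simp
    ring
  · simp [image_eq_zero_of_notMem_tsupport hξ]

theorem IsOfOrderOn.hasDerivAt_cauchyQuotient {h : TestFn} {N : ℕ}
    (hA : IsOfOrderOn A (tsupport h) N) {ζ₀ : ℂ} (hζ₀ : ∀ ξ ∈ tsupport h, ζ₀ ≠ ((ξ : ℝ) : ℂ)) :
    HasDerivAt (fun ζ => A (cauchyQuotient h ζ))
      (-A (cauchyQuotient (cauchyQuotient h ζ₀) ζ₀)) ζ₀ := by
  set k := cauchyQuotient (cauchyQuotient h ζ₀) ζ₀ with hk
  have s : tsupport k ⊆ tsupport h :=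
    (tsupport_cauchyQuotient_subset _ ζ₀).trans (tsupport_cauchyQuotient_subset h ζ₀)
  have hcl : IsClosed (Complex.ofReal '' tsupport h) :=
    (h.hasCompactSupport.isCompact.image Complex.continuous_ofReal).isClosed
  have hmem : (Complex.ofReal '' tsupport h)ᶜ ∈ nhds ζ₀ := by
    refine hcl.isOpen_compl.mem_nhds ?_
    rintro ⟨ξ, hξ, rfl⟩
    exact hζ₀ ξ hξ rfl
  obtain ⟨r, hr, hball⟩ := Metric.mem_nhds_iff.1 hmem
  obtain ⟨C, hC, hb⟩ := (hA.mono s le_rfl).exists_norm_cauchyQuotient_le (r / 2)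
  rw [hasDerivAt_iff_isLittleO]
  have hbig : (fun ζ => A (cauchyQuotient h ζ) - A (cauchyQuotient h ζ₀) -
      (ζ - ζ₀) • -A k) =O[nhds ζ₀] fun ζ => (ζ - ζ₀) ^ 2 := by
    refine Asymptotics.IsBigO.of_bound (C * (r / 2)⁻¹ ^ (N + 1)) ?_
    -- Within `r / 2` of `ζ₀` the distance to the support stays at least `r / 2`, so the remainder
    -- quotient is uniformly bounded under `A`.
    filter_upwards [Metric.ball_mem_nhds ζ₀ (half_pos hr)] with ζ hζ
    have hdist : ∀ ξ ∈ tsupport h, r / 2 ≤ ‖ζ - ((ξ : ℝ) : ℂ)‖ := by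
      intro ξ hξ
      by_contra! hlt
      rw [← dist_eq_norm, dist_comm] at hlt
      have h2 := Metric.mem_ball.1 hζ
      have h3 := dist_triangle (ξ : ℂ) ζ ζ₀
      have hm : (ξ : ℂ) ∈ Metric.ball ζ₀ r := by
        rw [Metric.mem_ball]
        linarith
      exact hball hm ⟨ξ, hξ, rfl⟩
    have hne : ∀ ξ ∈ tsupport h, ζ ≠ ((ξ : ℝ) : ℂ) := fun ξ hξ =>
      ne_of_forall_le_norm_sub (half_pos hr) hdist hξ
    have e := congrArg A (cauchyQuotient_sub hne hζ₀)
    simp only [map_add, map_sub, map_smul] at e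
    rw [smul_neg, sub_neg_eq_add, e, norm_smul, mul_comm]
    gcongr
    exact hb _ (half_pos hr) le_rfl ζ fun ξ hξ => hdist ξ (s hξ)
  refine hbig.trans_isLittleO ?_
  have := (Asymptotics.isBigO_refl (fun ζ : ℂ => ζ - ζ₀) (nhds ζ₀)).mul_isLittleO
    ((Asymptotics.isLittleO_one_iff ℂ).2 (show Filter.Tendsto (fun ζ : ℂ => ζ - ζ₀) (nhds ζ₀) (nhds 0) by
      have : Continuous fun ζ : ℂ => ζ - ζ₀ := by fun_prop
      simpa using this.tendsto ζ₀))
  simpa [sq] using this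

theorem IsOfOrderOn.differentiableOn_cauchyQuotient {h : TestFn} {N : ℕ}
    (hA : IsOfOrderOn A (tsupport h) N) :
    DifferentiableOn ℂ (fun ζ => A (cauchyQuotient h ζ)) (Complex.ofReal '' tsupport h)ᶜ :=
  fun _ hζ => (hA.hasDerivAt_cauchyQuotient fun ξ hξ e =>
    hζ ⟨ξ, hξ, e.symm⟩).differentiableAt.differentiableWithinAt

theorem IsOfOrderOn.differentiableOn_cauchyCutoff {h : TestFn} {N : ℕ}
    (hA : IsOfOrderOn A (tsupport h) N) :
    DifferentiableOn ℂ (fun ζ => A (cauchyCutoff h ζ)) {ζ : ℂ | ζ.im ≠ 0} := by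
  refine (hA.differentiableOn_cauchyQuotient.mono ?_).congr fun ζ hζ => by
    rw [cauchyCutoff_eq_cauchyQuotient h hζ]
  rintro ζ hζ ⟨ξ, -, rfl⟩
  simp at hζ

end LinearMap

/-! ### Extension across the real axis -/

theorem ae_im_ne_zero : ∀ᵐ ζ : ℂ, ζ.im ≠ 0 := by
  rw [MeasureTheory.ae_iff]
  have h : (LinearMap.ker Complex.imLm : Submodule ℝ ℂ) ≠ ⊤ := by
    intro e
    have : Complex.I ∈ LinearMap.ker Complex.imLm := by rw [e]; trivial
    simp at this
  convert! MeasureTheory.Measure.addHaar_submodule MeasureTheory.volume _ h using 2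
  ext ζ
  simp

theorem dense_im_ne_zero : Dense {ζ : ℂ | ζ.im ≠ 0} :=
  MeasureTheory.Measure.dense_of_ae ae_im_ne_zero

theorem isOpen_im_ne_zero : IsOpen {ζ : ℂ | ζ.im ≠ 0} :=
  isOpen_ne_fun Complex.continuous_im continuous_const

/-- Local holomorphic extensions of a function across the real axis glue together. -/
theorem exists_differentiableOn_extension_of_local {E : Type*} [NormedAddCommGroup E]
    [NormedSpace ℂ E] {f : ℂ → E} {U : Set ℂ}
    (h : ∀ p ∈ U, ∃ V : Set ℂ, IsOpen V ∧ p ∈ V ∧ ∃ G : ℂ → E, DifferentiableOn ℂ G V ∧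
      ∀ ζ ∈ V, ζ.im ≠ 0 → G ζ = f ζ) :
    ∃ F : ℂ → E, DifferentiableOn ℂ F U ∧ ∀ ζ ∈ U, ζ.im ≠ 0 → F ζ = f ζ := by
  -- Each local extension is the limit of `f` along the dense set of nonreal points, hence
  -- independent of the chosen neighbourhood.
  have key : ∀ V : Set ℂ, IsOpen V → ∀ G : ℂ → E, DifferentiableOn ℂ G V →
      (∀ ζ ∈ V, ζ.im ≠ 0 → G ζ = f ζ) → ∀ q ∈ V, extendFrom {ζ : ℂ | ζ.im ≠ 0} f q = G q := by
    intro V hV G hG hGf q hq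
    refine extendFrom_eq (dense_im_ne_zero q) ?_
    have hc : Filter.Tendsto G (nhdsWithin q {ζ : ℂ | ζ.im ≠ 0}) (nhds (G q)) :=
      (hG.continuousOn.continuousAt (hV.mem_nhds hq)).mono_left nhdsWithin_le_nhds
    refine hc.congr' ?_
    filter_upwards [self_mem_nhdsWithin, mem_nhdsWithin_of_mem_nhds (hV.mem_nhds hq)] with ζ h₁ h₂
    exact hGf ζ h₂ h₁
  refine ⟨extendFrom {ζ : ℂ | ζ.im ≠ 0} f, fun p hp => ?_, fun p hp hp' => ?_⟩
  · obtain ⟨V, hV, hpV, G, hG, hGf⟩ := h p hp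
    refine ((hG.differentiableAt (hV.mem_nhds hpV)).congr_of_eventuallyEq ?_).differentiableWithinAt
    filter_upwards [hV.mem_nhds hpV] with q hq using key V hV G hG hGf q hq
  · obtain ⟨V, hV, hpV, G, hG, hGf⟩ := h p hp
    rw [key V hV G hG hGf p hpV, hGf p hpV hp']

theorem tsupport_smoothMul_subset_left (g : ℝ → ℂ) (hg : ContDiff ℝ ∞ g) (φ : TestFn) :
    tsupport (smoothMul g hg φ) ⊆ tsupport g :=
  tsupport_mul_subset_left

/-- If a distribution vanishes near a real point, its Cauchy transform extends across it. -/
theorem exists_extension_of_isVanishingOn {E : Type*} [NormedAddCommGroup E] [NormedSpace ℂ E]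
    (A : TestFn →L[ℂ] E) (χ : TestFn) {s : Set ℝ} (hs : IsOpen s)
    (hA : Distribution.IsVanishingOn A s) {p : ℝ} (hp : p ∈ s) :
    ∃ V : Set ℂ, IsOpen V ∧ (p : ℂ) ∈ V ∧ ∃ G : ℂ → E, DifferentiableOn ℂ G V ∧
      ∀ ζ ∈ V, ζ.im ≠ 0 → G ζ = A (cauchyCutoff χ ζ) := by
  obtain ⟨r, hr, hball⟩ := Metric.mem_nhds_iff.1 (hs.mem_nhds hp)
  let b : ContDiffBump p := ⟨r / 4, r / 2, by positivity, by linarith⟩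
  have hb : ContDiff ℝ ∞ (fun ξ => ((b ξ : ℝ) : ℂ)) := Complex.ofRealCLM.contDiff.comp b.contDiff
  let χ₁ := smoothMul _ hb χ
  have hχ₁ : tsupport χ₁ ⊆ s := by
    refine (tsupport_smoothMul_subset_left _ hb χ).trans ?_
    have : tsupport (fun ξ => ((b ξ : ℝ) : ℂ)) ⊆ tsupport b :=
      tsupport_comp_subset (g := ((↑) : ℝ → ℂ)) (by simp) b
    refine this.trans ?_
    rw [b.tsupport_eq]
    refine (Metric.closedBall_subset_ball ?_).trans hball
    change r / 2 < r
    linarith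
  -- `χ₁` carries `χ` near `p` and lives where `A` vanishes, while `h` is zero near `p`, so that its
  -- Cauchy quotient is regular there.
  let h := χ - χ₁
  have hpV : (p : ℂ) ∉ Complex.ofReal '' tsupport h := by
    rintro ⟨ξ, hξ, e⟩
    obtain rfl : ξ = p := by exact_mod_cast e
    refine notMem_tsupport_iff_eventuallyEq.2 ?_ hξ
    filter_upwards [b.eventuallyEq_one] with x hx
    change χ x - ((b x : ℝ) : ℂ) * χ x = 0
    simp [hx]
  have hcl : IsClosed (Complex.ofReal '' tsupport h) :=
    (h.hasCompactSupport.isCompact.image Complex.continuous_ofReal).isClosed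
  obtain ⟨N, hN⟩ := A.exists_isOfOrderOn h.hasCompactSupport.isCompact
  refine ⟨_, hcl.isOpen_compl, hpV, _, hN.differentiableOn_cauchyQuotient, fun ζ _ hζ => ?_⟩
  have h0 : A (cauchyCutoff χ₁ ζ) = 0 := by
    rw [cauchyCutoff_eq_cauchyQuotient _ hζ]
    exact hA _ ((tsupport_cauchyQuotient_subset χ₁ ζ).trans hχ₁)
  have h1 : cauchyCutoff χ ζ = cauchyQuotient h ζ + cauchyCutoff χ₁ ζ := by
    rw [cauchyCutoff_eq_cauchyQuotient _ hζ, cauchyCutoff_eq_cauchyQuotient _ hζ]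
    ext ξ
    change _ = cauchyQuotient h ζ ξ + cauchyQuotient χ₁ ζ ξ
    simp only [cauchyQuotient_apply fun ξ _ => ne_ofReal_of_im_ne_zero hζ ξ]
    change _ = _ * (χ ξ - χ₁ ξ) + _
    ring
  rw [h1, map_add, h0, add_zero]
  rfl

/-! ### Holomorphy, growth and continuation of the pseudoresolvent -/

section Hyperoperator

variable {X : Type*} [NormedAddCommGroup X] [NormedSpace ℂ X] (a : Hyperoperator X)

theorem differentiableOn_smulRight_of_differentiableOn {E : Type*} [NormedAddCommGroup E]
    [NormedSpace ℂ E] {G : ℂ → E} {V : Set ℂ} (hG : DifferentiableOn ℂ G V) :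
    DifferentiableOn ℂ (fun ζ => ContinuousLinearMap.smulRightL ℂ ℂ E 1
      ((2 * (Real.pi : ℂ) * Complex.I)⁻¹ • G ζ)) V :=
  (ContinuousLinearMap.smulRightL ℂ ℂ E 1).differentiable.comp_differentiableOn
    (hG.const_smul _)

theorem differentiableOn_pseudoresolvent (χ : TestFn) :
    DifferentiableOn ℂ (pseudoresolvent a χ) {ζ : ℂ | ζ.im ≠ 0} := by
  obtain ⟨N, hN⟩ := a.toCLM.exists_isOfOrderOn χ.hasCompactSupport.isCompact
  exact differentiableOn_smulRight_of_differentiableOn hN.differentiableOn_cauchyCutoff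

theorem exists_norm_pseudoresolvent_le (χ : TestFn) :
    ∃ M : ℕ, ∀ T : ℝ, ∃ C : ℝ, ∀ ζ : ℂ, 0 < |ζ.im| → |ζ.im| ≤ T →
      ‖pseudoresolvent a χ ζ‖ ≤ C * (|ζ.im| ^ M)⁻¹ := by
  obtain ⟨N, hN⟩ := a.toCLM.exists_isOfOrderOn χ.hasCompactSupport.isCompact
  -- The order `N` depends only on `supp χ`, so the exponent is fixed before `T`.
  refine ⟨N + 1, fun T => ?_⟩
  obtain ⟨C, -, hC⟩ := hN.exists_norm_cauchyCutoff_le T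
  refine ⟨‖(2 * (Real.pi : ℂ) * Complex.I)⁻¹‖ * C, fun ζ hζ hT => ?_⟩
  rw [pseudoresolvent, ContinuousLinearMap.norm_smulRight_apply, norm_one, one_mul, norm_smul,
    ← inv_pow]
  exact (mul_le_mul_of_nonneg_left (hC ζ (abs_pos.1 hζ) hT) (norm_nonneg _)).trans_eq
    (mul_assoc _ _ _).symm

theorem exists_pseudoresolvent_extension (χ : TestFn) :
    ∃ F : ℂ → ℂ →L[ℂ] (X →L[ℂ] X), DifferentiableOn ℂ F (Complex.ofReal '' a.spectrum)ᶜ ∧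
      ∀ ζ : ℂ, ζ.im ≠ 0 → F ζ = pseudoresolvent a χ ζ := by
  have hU : ∀ p : ℂ, p.im ≠ 0 → p ∈ (Complex.ofReal '' a.spectrum)ᶜ := by
    rintro _ hp ⟨ξ, -, rfl⟩
    simp at hp
  obtain ⟨F, hF, hF'⟩ := exists_differentiableOn_extension_of_local (f := pseudoresolvent a χ)
    (U := (Complex.ofReal '' a.spectrum)ᶜ) fun p hp => by
      by_cases hp' : p.im = 0
      · obtain ⟨q, rfl⟩ : ∃ q : ℝ, p = (q : ℂ) := ⟨p.re, by
          apply Complex.ext <;> simp [hp']⟩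
        have hq : q ∉ a.spectrum := fun hq => hp ⟨q, hq, rfl⟩
        obtain ⟨s, hs, hs', hqs⟩ := (Distribution.notMem_dsupport_iff q).1 hq
        obtain ⟨V, hV, hqV, G, hG, hG'⟩ := exists_extension_of_isVanishingOn a.toCLM χ hs' hs hqs
        refine ⟨V, hV, hqV, _, differentiableOn_smulRight_of_differentiableOn hG,
          fun ζ hζ hζ' => ?_⟩
        rw [hG' ζ hζ hζ']
        rfl
      · exact ⟨_, isOpen_im_ne_zero, hp', _, differentiableOn_pseudoresolvent a χ,
          fun _ _ _ => rfl⟩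
  exact ⟨F, hF, fun ζ hζ => hF' ζ (hU ζ hζ) hζ⟩

end Hyperoperator

/-! ### The `∂̄` operator and the Cauchy–Pompeiu formula -/

section Representation

open MeasureTheory Set

theorem dbar_apply_one (f : ℂ → ℂ) (ζ : ℂ) : dbar f ζ 1 =
    1 / 2 * (fderiv ℝ f ζ 1 + Complex.I * fderiv ℝ f ζ Complex.I) := by
  simp [dbar, Complex.real_smul]
  ring

theorem dbar_apply_I (f : ℂ → ℂ) (ζ : ℂ) : dbar f ζ Complex.I = -Complex.I * dbar f ζ 1 := by
  have h : fderiv ℝ f ζ (-1) = -fderiv ℝ f ζ 1 := map_neg _ _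
  simp only [dbar_apply_one]
  simp [dbar, Complex.real_smul, h]
  linear_combination (1 / 2 * fderiv ℝ f ζ Complex.I) * Complex.I_mul_I

/-- This is `dζ ∧ dζ̄ = -2i dx ∧ dy`, for `α` of type `(1,0)` and `∂̄f` of type `(0,1)`. -/
theorem wedge_one_I {E : Type*} [NormedAddCommGroup E] [NormedSpace ℂ E]
    (α : ℂ →L[ℂ] E) (f : ℂ → ℂ) (ζ : ℂ) :
    wedge α (dbar f ζ) 1 Complex.I = (-2 * Complex.I * dbar f ζ 1) • α 1 := by
  have h : α Complex.I = Complex.I • α 1 := by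
    rw [← map_smul, smul_eq_mul, mul_one]
  rw [wedge, dbar_apply_I, h, smul_smul, ← sub_smul]
  ring_nf

/-- The polar form `∂̄ = (e^{iθ} / 2)(∂_r + (i / r) ∂_θ)`; the phase of the Cauchy kernel cancels
`e^{iθ}`. -/
theorem polar_dbar (L : ℂ →L[ℝ] ℂ) (θ : ℝ) :
    (1 / 2 * (L 1 + Complex.I * L Complex.I)) * ((Real.cos θ : ℂ) + Real.sin θ * Complex.I)⁻¹ =
      1 / 2 * (L (Real.cos θ + Real.sin θ * Complex.I) +
        Complex.I * L (Complex.I * (Real.cos θ + Real.sin θ * Complex.I))) := by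
  have h1 : L (Real.cos θ + Real.sin θ * Complex.I) = Real.cos θ * L 1 + Real.sin θ * L Complex.I := by
    have : (Real.cos θ + Real.sin θ * Complex.I : ℂ) = Real.cos θ • (1 : ℂ) + Real.sin θ • Complex.I := by
      simp [Complex.real_smul]
    rw [this, map_add, map_smul, map_smul, Complex.real_smul, Complex.real_smul]
  have h2 : L (Complex.I * (Real.cos θ + Real.sin θ * Complex.I)) =
      Real.cos θ * L Complex.I - Real.sin θ * L 1 := by
    have : (Complex.I * (Real.cos θ + Real.sin θ * Complex.I) : ℂ) =
        Real.cos θ • Complex.I - Real.sin θ • (1 : ℂ) := by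
      simp only [Complex.real_smul]
      linear_combination (Real.sin θ : ℂ) * Complex.I_mul_I
    rw [this, map_sub, map_smul, map_smul, Complex.real_smul, Complex.real_smul]
  have h3 : ((Real.cos θ : ℂ) ^ 2 + (Real.sin θ : ℂ) ^ 2) = 1 := by
    exact_mod_cast Real.cos_sq_add_sin_sq θ
  have h4 : ((Real.cos θ : ℂ) + Real.sin θ * Complex.I)⁻¹ = Real.cos θ - Real.sin θ * Complex.I := by
    refine inv_eq_of_mul_eq_one_right ?_
    linear_combination h3 - (Real.sin θ : ℂ) ^ 2 * Complex.I_mul_I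
  rw [h4, h1, h2]
  linear_combination (-1 / 2 * Real.sin θ * L Complex.I) * Complex.I_mul_I

/-- The **Cauchy–Pompeiu formula** for compactly supported functions. -/
theorem integral_dbar_mul_inv_sub {f : ℂ → ℂ} (hf : ContDiff ℝ 1 f) (hc : HasCompactSupport f)
    (w : ℂ) : ∫ ζ : ℂ, dbar f ζ 1 * (ζ - w)⁻¹ = -Real.pi * f w := by
  set e : ℝ → ℂ := fun θ => Real.cos θ + Real.sin θ * Complex.I with he
  have hec : Continuous e := by fun_prop
  have hen : ∀ θ, ‖e θ‖ = 1 := fun θ => by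
    have : e θ = Complex.exp (θ * Complex.I) := by
      rw [Complex.exp_mul_I]; simp [he]
    rw [this, Complex.norm_exp_ofReal_mul_I]
  have he' : ∀ θ, HasDerivAt e (Complex.I * e θ) θ := fun θ => by
    have := ((Real.hasDerivAt_cos θ).ofReal_comp).add
      (((Real.hasDerivAt_sin θ).ofReal_comp).mul_const Complex.I)
    refine this.congr_deriv ?_
    simp only [he]
    push_cast
    linear_combination -(Complex.sin θ) * Complex.I_mul_I
  have hfd : Continuous (fderiv ℝ f) := hf.continuous_fderiv one_ne_zero
  have hdf : ∀ z, HasFDerivAt f (fderiv ℝ f z) z := fun z =>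
    (hf.differentiable one_ne_zero z).hasFDerivAt
  -- For `r > 0`, `P` is the radial derivative of `f` about `w` and `Q` is `1 / r` times the angular
  -- one. The Jacobian cancels the singularity of the kernel, so both enter as continuous functions.
  -- `Q` integrates to zero over each circle by periodicity, and `P` integrates to `-f w` along each
  -- ray.
  let P : ℝ × ℝ → ℂ := fun p => fderiv ℝ f (w + p.1 * e p.2) (e p.2)
  let Q : ℝ × ℝ → ℂ := fun p => fderiv ℝ f (w + p.1 * e p.2) (Complex.I * e p.2)
  have hP : Continuous P := by fun_prop
  have hQ : Continuous Q := by fun_prop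
  obtain ⟨R, hR⟩ : ∃ R : ℝ, ∀ z : ℂ, R < ‖z‖ → z ∉ tsupport f := by
    obtain ⟨R, hR⟩ := hc.isCompact.isBounded.exists_norm_le
    exact ⟨R, fun z hz hz' => absurd (hR z hz') (not_le.2 hz)⟩
  have hfar : ∀ r θ : ℝ, R + ‖w‖ < r → w + r * e θ ∉ tsupport f := fun r θ hr => by
    refine hR _ ?_
    have h1 : ‖(r * e θ : ℂ)‖ ≤ ‖w + r * e θ‖ + ‖w‖ := by
      simpa using norm_sub_le (w + r * e θ) w
    rw [norm_mul, hen, mul_one, Complex.norm_real] at h1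
    have := le_abs_self r
    rw [Real.norm_eq_abs] at h1
    linarith
  have hfar' : ∀ r θ : ℝ, R + ‖w‖ < r → fderiv ℝ f (w + r * e θ) = 0 := fun r θ hr =>
    image_eq_zero_of_notMem_tsupport fun h => hfar r θ hr (tsupport_fderiv_subset ℝ h)
  have hint : ∀ F : ℝ × ℝ → ℂ, Continuous F → (∀ r θ, R + ‖w‖ < r → F (r, θ) = 0) →
      IntegrableOn F (Ioi (0 : ℝ) ×ˢ Ioo (-Real.pi) Real.pi) := fun F hF hF0 => by
    have h1 : IntegrableOn F (Icc 0 (R + ‖w‖) ×ˢ Icc (-Real.pi) Real.pi) :=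
      hF.continuousOn.integrableOn_compact (isCompact_Icc.prod isCompact_Icc)
    refine h1.of_forall_sdiff_eq_zero (measurableSet_Ioi.prod measurableSet_Ioo) ?_
    rintro ⟨r, θ⟩ ⟨⟨hr, hθ⟩, hn⟩
    refine hF0 r θ ?_
    by_contra! hle
    exact hn ⟨⟨le_of_lt hr, hle⟩, Ioo_subset_Icc_self hθ⟩
  have hPi := hint P hP fun r θ hr => by simp [P, hfar' r θ hr]
  have hQi := hint Q hQ fun r θ hr => by simp [Q, hfar' r θ hr]
  have hQ0 : ∫ p in Ioi (0 : ℝ) ×ˢ Ioo (-Real.pi) Real.pi, Q p = 0 := by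
    rw [Measure.volume_eq_prod] at hQi ⊢
    rw [setIntegral_prod _ hQi]
    refine setIntegral_eq_zero_of_forall_eq_zero fun r hr => ?_
    have hr0 : (r : ℂ) ≠ 0 := by exact_mod_cast (ne_of_gt hr)
    have hd : ∀ θ ∈ uIcc (-Real.pi) Real.pi,
        HasDerivAt (fun θ : ℝ => (r : ℂ)⁻¹ * f (w + r * e θ)) (Q (r, θ)) θ := fun θ _ => by
      have h1 : HasDerivAt (fun θ : ℝ => w + r * e θ) (r * (Complex.I * e θ)) θ :=
        ((he' θ).const_mul (r : ℂ)).const_add w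
      have h2 := ((hdf (w + r * e θ)).comp_hasDerivAt θ h1).const_mul (r : ℂ)⁻¹
      refine h2.congr_deriv ?_
      have h3 : (r * (Complex.I * e θ) : ℂ) = r • (Complex.I * e θ) := Complex.real_smul.symm
      rw [h3, map_smul, Complex.real_smul, inv_mul_cancel_left₀ hr0]
    have hci : IntervalIntegrable (fun θ => Q (r, θ)) volume (-Real.pi) Real.pi :=
      (hQ.comp (by fun_prop : Continuous fun θ : ℝ => (r, θ))).intervalIntegrable _ _
    have := intervalIntegral.integral_eq_sub_of_hasDerivAt hd hci
    rw [intervalIntegral.integral_of_le (by linarith [Real.pi_pos]),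
      integral_Ioc_eq_integral_Ioo] at this
    rw [this]
    simp [he]
  have hP0 : ∫ p in Ioi (0 : ℝ) ×ˢ Ioo (-Real.pi) Real.pi, P p = -(2 * Real.pi) * f w := by
    rw [Measure.volume_eq_prod] at hPi ⊢
    simp only [← Measure.prod_restrict, IntegrableOn] at hPi ⊢
    rw [integral_prod_symm _ hPi]
    have hin : ∀ θ : ℝ, ∫ r in Ioi (0 : ℝ), P (r, θ) = -f w := fun θ => by
      have hd : ∀ r ∈ Ici (0 : ℝ), HasDerivAt (fun r : ℝ => f (w + r * e θ)) (P (r, θ)) r :=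
        fun r _ => by
          have h1 : HasDerivAt (fun r : ℝ => w + r * e θ) (1 * e θ) r :=
            ((hasDerivAt_id r).ofReal_comp.mul_const (e θ)).const_add w
          rw [one_mul] at h1
          exact (hdf (w + r * e θ)).comp_hasDerivAt r h1
      have hi : IntegrableOn (fun r => P (r, θ)) (Ioi 0) := by
        have h1 : IntegrableOn (fun r => P (r, θ)) (Icc 0 (R + ‖w‖)) :=
          (hP.comp (by fun_prop : Continuous fun r : ℝ => (r, θ))).continuousOn.integrableOn_compact
            isCompact_Icc
        refine h1.of_forall_sdiff_eq_zero measurableSet_Ioi ?_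
        rintro r ⟨hr, hn⟩
        have : R + ‖w‖ < r := by
          by_contra! hle
          exact hn ⟨le_of_lt hr, hle⟩
        simp [P, hfar' r θ this]
      have ht : Filter.Tendsto (fun r : ℝ => f (w + r * e θ)) Filter.atTop (nhds 0) := by
        refine tendsto_const_nhds.congr' ?_
        filter_upwards [Filter.eventually_gt_atTop (R + ‖w‖)] with r hr
        exact (image_eq_zero_of_notMem_tsupport (hfar r θ hr)).symm
      rw [integral_Ioi_of_hasDerivAt_of_tendsto' hd hi ht]
      simp
    simp only [hin]
    rw [setIntegral_const, Measure.real, Real.volume_Ioo,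
      ENNReal.toReal_ofReal (by linarith [Real.pi_pos]), Complex.real_smul]
    push_cast
    ring
  have htr : ∫ ζ : ℂ, dbar f ζ 1 * (ζ - w)⁻¹ = ∫ ζ : ℂ, dbar f (w + ζ) 1 * ζ⁻¹ := by
    rw [← integral_add_left_eq_self _ w]
    simp
  rw [htr, ← Complex.integral_comp_polarCoord_symm]
  have hcongr : ∫ p in polarCoord.target, p.1 • (dbar f (w + Complex.polarCoord.symm p) 1 *
      (Complex.polarCoord.symm p)⁻¹) =
      ∫ p in Ioi (0 : ℝ) ×ˢ Ioo (-Real.pi) Real.pi, 1 / 2 * (P p + Complex.I * Q p) := by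
    refine setIntegral_congr_fun (measurableSet_Ioi.prod measurableSet_Ioo) ?_
    rintro ⟨r, θ⟩ ⟨hr, -⟩
    have hr0 : (r : ℂ) ≠ 0 := by exact_mod_cast (ne_of_gt hr)
    simp only [Complex.polarCoord_symm_apply, P, Q, he]
    rw [dbar_apply_one, ← polar_dbar, mul_inv, Complex.real_smul]
    field_simp
  rw [hcongr, integral_const_mul, integral_add hPi (hQi.const_mul _), integral_const_mul, hQ0, hP0]
  ring

/-! ### Exchanging a map of finite order with an integral -/

/-- In the quotient by `S`, normed because `S` is closed, the integrand becomes zero. A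
nonintegrable `f` has integral `0` by convention. -/
theorem Submodule.integral_mem_of_isClosed {α E : Type*} [MeasurableSpace α] {μ : Measure α}
    [NormedAddCommGroup E] [NormedSpace ℂ E] [CompleteSpace E] (S : Submodule ℂ E)
    (hS : IsClosed (S : Set E)) {f : α → E} (hf : ∀ x, f x ∈ S) : ∫ x, f x ∂μ ∈ S := by
  by_cases hi : Integrable f μ
  swap
  · rw [integral_undef hi]
    exact S.zero_mem
  have : IsClosed (S : Set E) := hS
  have h := S.mkQL.integral_comp_comm hi
  have h0 : ∀ x, S.mkQL (f x) = 0 := fun x => (Submodule.Quotient.mk_eq_zero S).2 (hf x)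
  simp only [h0, integral_zero] at h
  exact (Submodule.Quotient.mk_eq_zero S).1 h.symm

/-- The derivatives of order at most `N` of a test function, as bounded continuous functions. -/
noncomputable def jet (N : ℕ) : TestFn →ₗ[ℂ] (Fin (N + 1) → BoundedContinuousFunction ℝ ℂ) where
  toFun ψ i :=
    { toFun := iteratedDeriv i ψ
      continuous_toFun := ψ.contDiff.continuous_iteratedDeriv i (by exact_mod_cast le_top)
      map_bounded' := by
        obtain ⟨C, hC⟩ := (ψ.contDiff.continuous_iteratedDeriv i
          (by exact_mod_cast le_top)).bounded_above_of_compact_support (by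
            have := ψ.hasCompactSupport.iteratedFDeriv (𝕜 := ℝ) i
            refine this.mono' ?_
            intro x hx
            refine subset_closure ?_
            rw [Function.mem_support] at hx ⊢
            rw [← norm_ne_zero_iff] at hx ⊢
            rwa [norm_iteratedFDeriv_eq_norm_iteratedDeriv])
        exact ⟨C + C, fun x y => (dist_le_norm_add_norm _ _).trans (add_le_add (hC x) (hC y))⟩ }
  map_add' φ ψ := by
    ext i ξ
    exact iteratedDeriv_add (φ.contDiff.of_le (by exact_mod_cast le_top)).contDiffAt
      (ψ.contDiff.of_le (by exact_mod_cast le_top)).contDiffAt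
  map_smul' c ψ := by
    ext i ξ
    exact iteratedDeriv_const_smul_field c ψ

theorem norm_iteratedDeriv_le_norm_jet {N i : ℕ} (hi : i ≤ N) (ψ : TestFn) (ξ : ℝ) :
    ‖iteratedDeriv i ψ ξ‖ ≤ ‖jet N ψ‖ :=
  ((jet N ψ ⟨i, Nat.lt_succ_of_le hi⟩).norm_coe_le_norm ξ).trans (norm_le_pi_norm _ _)

theorem isOfOrderOn_jet (N : ℕ) (K : Set ℝ) : IsOfOrderOn (jet N) K N := by
  refine ⟨1, zero_le_one, fun ψ _ B hB => ?_⟩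
  have hB0 : 0 ≤ B := (norm_nonneg _).trans (hB 0 (Nat.zero_le _) 0)
  rw [one_mul]
  exact (pi_norm_le_iff_of_nonneg hB0).2 fun i => (BoundedContinuousFunction.norm_le hB0).2
    fun ξ => hB i (Nat.le_of_lt_succ i.2) ξ

/-- A linear map of finite order commutes with an integral of test functions which converges
together with all the derivatives up to that order. -/
theorem IsOfOrderOn.integral_eq {α E : Type*} [MeasurableSpace α] {μ : Measure α}
    [NormedAddCommGroup E] [NormedSpace ℂ E] [CompleteSpace E] {A : TestFn →ₗ[ℂ] E} {K : Set ℝ}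
    {N : ℕ} (hA : IsOfOrderOn A K N) {u : α → TestFn} (hu : ∀ x, tsupport (u x) ⊆ K)
    (hi : Integrable (fun x => A (u x)) μ) (hj : Integrable (fun x => jet N (u x)) μ)
    {ψ : TestFn} (hψ : tsupport ψ ⊆ K) (h : ∫ x, jet N (u x) ∂μ = jet N ψ) :
    ∫ x, A (u x) ∂μ = A ψ := by
  obtain ⟨C, hC, hb⟩ := hA
  let D : Submodule ℂ TestFn :=
    { carrier := {φ | tsupport φ ⊆ K}
      zero_mem' := by
        change tsupport (0 : ℝ → ℂ) ⊆ K
        simp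
      add_mem' := fun {φ₁ φ₂} h₁ h₂ => (tsupport_add φ₁ φ₂).trans (union_subset h₁ h₂)
      smul_mem' := fun c φ hφ => (tsupport_smul_subset_right (fun _ => c) φ).trans hφ }
  let S : Submodule ℂ (E × (Fin (N + 1) → BoundedContinuousFunction ℝ ℂ)) :=
    D.map (A.prod (jet N))
  -- The integral is taken in a Banach space of pairs, not among test functions. It lies in the
  -- closure of the pairs `(A φ, jet N φ)`; a nearby pair has `jet N φ` close to `jet N ψ`, and
  -- finite order then makes `A φ` close to `A ψ`.
  have hmem : (∫ x, A (u x) ∂μ, jet N ψ) ∈ S.topologicalClosure := by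
    rw [← h, ← integral_pair hi hj]
    exact Submodule.integral_mem_of_isClosed _ S.isClosed_topologicalClosure fun x =>
      S.le_topologicalClosure ⟨u x, hu x, rfl⟩
  refine eq_of_forall_dist_le fun ε hε => ?_
  obtain ⟨_, ⟨φ, hφ, rfl⟩, hd⟩ := Metric.mem_closure_iff.1 hmem (ε / (1 + C)) (by positivity)
  rw [Prod.dist_eq, max_lt_iff] at hd
  obtain ⟨h₁, h₂⟩ := hd
  change dist _ (A φ) < _ at h₁
  change dist _ (jet N φ) < _ at h₂
  have h₃ : ‖A (φ - ψ)‖ ≤ C * (ε / (1 + C)) := by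
    have hs : tsupport (φ - ψ : TestFn) ⊆ K := D.sub_mem hφ hψ
    refine (hb _ hs _ fun i hi ξ => norm_iteratedDeriv_le_norm_jet hi _ ξ).trans ?_
    rw [map_sub, ← dist_eq_norm, dist_comm]
    gcongr
  rw [map_sub, ← dist_eq_norm] at h₃
  calc dist (∫ x, A (u x) ∂μ) (A ψ) ≤ dist (∫ x, A (u x) ∂μ) (A φ) + dist (A φ) (A ψ) :=
        dist_triangle _ _ _
    _ ≤ ε / (1 + C) + C * (ε / (1 + C)) := add_le_add h₁.le h₃
    _ = ε := by field_simp

/-! ### The representation formula for maps of finite order -/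

section Flat

variable {E : Type*} [NormedAddCommGroup E] [NormedSpace ℂ E] {A : TestFn →ₗ[ℂ] E} {χ : TestFn}
  {N : ℕ} {f : ℂ → ℂ} {C : ℝ}

theorem continuous_dbar_apply_one (hf : ContDiff ℝ 1 f) : Continuous fun ζ => dbar f ζ 1 := by
  have h : Continuous (fderiv ℝ f) := hf.continuous_fderiv one_ne_zero
  simp only [dbar_apply_one]
  fun_prop

theorem dbar_eq_zero_of_notMem_tsupport {ζ : ℂ} (h : ζ ∉ tsupport f) : dbar f ζ 1 = 0 := by
  have : fderiv ℝ f ζ = 0 :=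
    image_eq_zero_of_notMem_tsupport fun h' => h (tsupport_fderiv_subset ℝ h')
  simp [dbar_apply_one, this]

/-- Flatness of order `N + 1` exactly cancels the growth `|Im ζ|^{-(N+1)}`. -/
theorem IsOfOrderOn.exists_norm_dbar_smul_le (hA : IsOfOrderOn A (tsupport χ) N)
    (hc : HasCompactSupport f) (hflat : ∀ ζ, ‖dbar f ζ 1‖ ≤ C * |ζ.im| ^ (N + 1)) :
    ∃ B : ℝ, ∀ ζ : ℂ, ζ.im ≠ 0 → ‖dbar f ζ 1 • A (cauchyCutoff χ ζ)‖ ≤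
      (tsupport f).indicator (fun _ => B) ζ := by
  obtain ⟨R, hR⟩ := hc.isCompact.isBounded.exists_norm_le
  obtain ⟨C', hC', hb⟩ := hA.exists_norm_cauchyCutoff_le R
  refine ⟨C * C', fun ζ hζ => ?_⟩
  by_cases hs : ζ ∈ tsupport f
  · rw [indicator_of_mem hs, norm_smul]
    have hpos : 0 < |ζ.im| := abs_pos.2 hζ
    calc _ ≤ (C * |ζ.im| ^ (N + 1)) * (C' * |ζ.im|⁻¹ ^ (N + 1)) := by
          refine mul_le_mul (hflat ζ) (hb ζ hζ ((Complex.abs_im_le_norm ζ).trans (hR ζ hs)))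
            (norm_nonneg _) ((norm_nonneg _).trans (hflat ζ))
      _ = C * C' * (|ζ.im| * |ζ.im|⁻¹) ^ (N + 1) := by rw [mul_pow]; ring
      _ = C * C' := by rw [mul_inv_cancel₀ hpos.ne', one_pow, mul_one]
  · rw [indicator_of_notMem hs, dbar_eq_zero_of_notMem_tsupport hs]
    simp

theorem integrable_indicator_tsupport (hc : HasCompactSupport f) (B : ℝ) :
    Integrable ((tsupport f).indicator fun _ : ℂ => B) :=
  (integrable_indicator_iff (isClosed_tsupport f).measurableSet).2
    (integrableOn_const hc.isCompact.measure_lt_top.ne)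

theorem aestronglyMeasurable_of_continuousOn_im_ne_zero {Z : Type*} [NormedAddCommGroup Z]
    {g : ℂ → Z} (hg : ContinuousOn g {ζ : ℂ | ζ.im ≠ 0}) : AEStronglyMeasurable g := by
  have h := hg.aestronglyMeasurable (μ := volume) isOpen_im_ne_zero.measurableSet
  have hr : volume.restrict {ζ : ℂ | ζ.im ≠ 0} = volume :=
    Measure.restrict_eq_self_of_ae_mem ae_im_ne_zero
  rwa [hr] at h

theorem IsOfOrderOn.integrable_dbar_smul (hA : IsOfOrderOn A (tsupport χ) N)
    (hf : ContDiff ℝ 1 f) (hc : HasCompactSupport f)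
    (hflat : ∀ ζ, ‖dbar f ζ 1‖ ≤ C * |ζ.im| ^ (N + 1)) :
    Integrable fun ζ => dbar f ζ 1 • A (cauchyCutoff χ ζ) := by
  obtain ⟨B, hB⟩ := hA.exists_norm_dbar_smul_le hc hflat
  refine (integrable_indicator_tsupport hc B).mono' ?_ ?_
  · exact aestronglyMeasurable_of_continuousOn_im_ne_zero
      ((continuous_dbar_apply_one hf).continuousOn.smul hA.differentiableOn_cauchyCutoff.continuousOn)
  · filter_upwards [ae_im_ne_zero] with ζ hζ using hB ζ hζ

/-- The map `jet N` itself has order `N`, so its Cauchy transform is integrable against `∂̄f`; then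
evaluate one component at `ξ`. -/
theorem integrable_dbar_mul_iteratedDeriv (hf : ContDiff ℝ 1 f) (hc : HasCompactSupport f)
    (hflat : ∀ ζ, ‖dbar f ζ 1‖ ≤ C * |ζ.im| ^ (N + 1)) {i : ℕ} (hi : i ≤ N) (ξ : ℝ) :
    Integrable fun ζ => dbar f ζ 1 * iteratedDeriv i (cauchyCutoff χ ζ) ξ := by
  have h := (isOfOrderOn_jet N (tsupport χ)).integrable_dbar_smul hf hc hflat
  have h' := (BoundedContinuousFunction.evalCLM ℂ ξ).integrable_comp
    ((ContinuousLinearMap.proj (R := ℂ) (φ := fun _ : Fin (N + 1) => BoundedContinuousFunction ℝ ℂ)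
      ⟨i, Nat.lt_succ_of_le hi⟩).integrable_comp h)
  exact h'

/-- The bound on the jet is uniform in `ξ`, hence a dominating function for differentiation under
the integral. -/
theorem hasDerivAt_integral_dbar_mul_iteratedDeriv (hf : ContDiff ℝ 1 f) (hc : HasCompactSupport f)
    (hflat : ∀ ζ, ‖dbar f ζ 1‖ ≤ C * |ζ.im| ^ (N + 1)) {i : ℕ} (hi : i + 1 ≤ N) (ξ : ℝ) :
    HasDerivAt (fun ξ => ∫ ζ : ℂ, dbar f ζ 1 * iteratedDeriv i (cauchyCutoff χ ζ) ξ)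
      (∫ ζ : ℂ, dbar f ζ 1 * iteratedDeriv (i + 1) (cauchyCutoff χ ζ) ξ) ξ := by
  obtain ⟨B, hB⟩ := (isOfOrderOn_jet N (tsupport χ)).exists_norm_dbar_smul_le hc hflat
  refine (hasDerivAt_integral_of_dominated_loc_of_deriv_le (s := univ)
    (F := fun ξ ζ => dbar f ζ 1 * iteratedDeriv i (cauchyCutoff χ ζ) ξ)
    (F' := fun ξ ζ => dbar f ζ 1 * iteratedDeriv (i + 1) (cauchyCutoff χ ζ) ξ)
    (bound := (tsupport f).indicator fun _ => B) Filter.univ_mem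
    (Filter.Eventually.of_forall fun ξ =>
      (integrable_dbar_mul_iteratedDeriv hf hc hflat (by omega) ξ).aestronglyMeasurable)
    (integrable_dbar_mul_iteratedDeriv hf hc hflat (by omega) ξ)
    (integrable_dbar_mul_iteratedDeriv hf hc hflat hi ξ).aestronglyMeasurable ?_
    (integrable_indicator_tsupport hc B) ?_).2
  · filter_upwards [ae_im_ne_zero] with ζ hζ ξ _
    refine le_trans ?_ (hB ζ hζ)
    rw [norm_mul, norm_smul]
    gcongr
    exact norm_iteratedDeriv_le_norm_jet hi _ ξ
  · filter_upwards with ζ ξ _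
    refine HasDerivAt.const_mul _ ?_
    rw [iteratedDeriv_succ]
    exact (((cauchyCutoff χ ζ).contDiff.differentiable_iteratedDeriv i
      (by exact_mod_cast ENat.natCast_lt_top i)) ξ).hasDerivAt

theorem integral_dbar_mul_iteratedDeriv (hf : ContDiff ℝ 1 f) (hc : HasCompactSupport f)
    (hflat : ∀ ζ, ‖dbar f ζ 1‖ ≤ C * |ζ.im| ^ (N + 1)) {φ : TestFn}
    (hfφ : ∀ ξ : ℝ, f ξ = φ ξ) (hφ : tsupport φ ⊆ {ξ : ℝ | χ ξ = 1}) {i : ℕ} (hi : i ≤ N) :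
    ∀ ξ : ℝ, ∫ ζ : ℂ, dbar f ζ 1 * iteratedDeriv i (cauchyCutoff χ ζ) ξ =
      -Real.pi * iteratedDeriv i φ ξ := by
  induction i with
  | zero =>
    intro ξ
    have h : ∫ ζ : ℂ, dbar f ζ 1 * iteratedDeriv 0 (cauchyCutoff χ ζ) ξ =
        ∫ ζ : ℂ, (dbar f ζ 1 * (ζ - ξ)⁻¹) * χ ξ := by
      refine integral_congr_ae ?_
      filter_upwards [ae_im_ne_zero] with ζ hζ
      rw [iteratedDeriv_zero, cauchyCutoff_eq_cauchyQuotient χ hζ,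
        cauchyQuotient_apply fun ξ _ => ne_ofReal_of_im_ne_zero hζ ξ, mul_assoc]
    rw [h, integral_mul_const, integral_dbar_mul_inv_sub hf hc, iteratedDeriv_zero, hfφ]
    by_cases hξ : ξ ∈ tsupport φ
    · rw [show χ ξ = 1 from hφ hξ, mul_one]
    · simp [image_eq_zero_of_notMem_tsupport hξ]
  | succ i ih =>
    intro ξ
    rw [← (hasDerivAt_integral_dbar_mul_iteratedDeriv hf hc hflat hi ξ).deriv,
      funext (ih (by omega)), iteratedDeriv_succ, deriv_const_mul_field]

/-- Representation of a distribution of finite order by its Cauchy transform, for extensions with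
`∂̄f` vanishing to sufficiently high finite order on the real axis. -/
theorem IsOfOrderOn.integral_dbar_smul [CompleteSpace E] (hA : IsOfOrderOn A (tsupport χ) N)
    (hf : ContDiff ℝ 1 f) (hc : HasCompactSupport f)
    (hflat : ∀ ζ, ‖dbar f ζ 1‖ ≤ C * |ζ.im| ^ (N + 1)) {φ : TestFn}
    (hfφ : ∀ ξ : ℝ, f ξ = φ ξ) (hφ : tsupport φ ⊆ {ξ : ℝ | χ ξ = 1}) :
    ∫ ζ : ℂ, dbar f ζ 1 • A (cauchyCutoff χ ζ) = (-Real.pi : ℂ) • A φ := by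
  have hJ := (isOfOrderOn_jet N (tsupport χ)).integrable_dbar_smul hf hc hflat
  have hφχ : tsupport φ ⊆ tsupport χ := fun ξ hξ => subset_closure (by
    rw [Function.mem_support, show χ ξ = 1 from hφ hξ]
    exact one_ne_zero)
  have hs : ∀ ζ, tsupport (dbar f ζ 1 • cauchyCutoff χ ζ) ⊆ tsupport χ := fun ζ => by
    refine (tsupport_smul_subset_right (fun _ => dbar f ζ 1) (cauchyCutoff χ ζ)).trans ?_
    -- The support condition is needed at every `ζ`; on the real axis `cauchyCutoff` has the default
    -- value `0`.
    by_cases hζ : ζ.im = 0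
    · have : ⇑(cauchyCutoff χ ζ) = 0 := by
        rw [cauchyCutoff, dif_neg (not_not.2 hζ)]
        rfl
      rw [this]
      simp
    · rw [cauchyCutoff_eq_cauchyQuotient χ hζ]
      exact tsupport_cauchyQuotient_subset χ ζ
  have h := hA.integral_eq (μ := volume) (u := fun ζ => dbar f ζ 1 • cauchyCutoff χ ζ)
    (ψ := (-Real.pi : ℂ) • φ) hs
    (by simpa only [map_smul] using hA.integrable_dbar_smul hf hc hflat)
    (by simpa only [map_smul] using hJ)
    ((tsupport_smul_subset_right (fun _ => (-Real.pi : ℂ)) φ).trans hφχ) ?_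
  · simpa only [map_smul] using h
  · simp only [map_smul]
    ext i ξ
    have e₁ := (ContinuousLinearMap.proj (R := ℂ)
      (φ := fun _ : Fin (N + 1) => BoundedContinuousFunction ℝ ℂ) i).integral_comp_comm hJ
    have e₂ := (BoundedContinuousFunction.evalCLM ℂ ξ).integral_comp_comm
      ((ContinuousLinearMap.proj (R := ℂ)
        (φ := fun _ : Fin (N + 1) => BoundedContinuousFunction ℝ ℂ) i).integrable_comp hJ)
    rw [e₁] at e₂
    exact e₂.symm.trans
      (integral_dbar_mul_iteratedDeriv hf hc hflat hfφ hφ (Nat.le_of_lt_succ i.2) ξ)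

end Flat

/-! ### Extensions flat to finite order -/

/-- The `k`-th term in the Taylor expansion of a smooth function in the imaginary direction. -/
noncomputable def imTaylorTerm (φ : ℝ → ℂ) (k : ℕ) (ζ : ℂ) : ℂ :=
  iteratedDeriv k φ ζ.re * ((k.factorial : ℂ)⁻¹ * (Complex.I * ζ.im) ^ k)

/-- The Taylor polynomial of order `n` of a smooth function in the imaginary direction. -/
noncomputable def imTaylor (φ : ℝ → ℂ) (n : ℕ) (ζ : ℂ) : ℂ :=
  ∑ k ∈ Finset.range (n + 1), imTaylorTerm φ k ζ

theorem contDiff_iteratedDeriv {φ : ℝ → ℂ} (hφ : ContDiff ℝ ∞ φ) (k : ℕ) :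
    ContDiff ℝ ∞ (iteratedDeriv k φ) := by
  rw [iteratedDeriv_eq_iterate]
  exact hφ.iterate_deriv k

theorem contDiff_imTaylorTerm {φ : ℝ → ℂ} (hφ : ContDiff ℝ ∞ φ) (k : ℕ) :
    ContDiff ℝ ∞ (imTaylorTerm φ k) := by
  refine ((contDiff_iteratedDeriv hφ k).comp Complex.reCLM.contDiff).mul (contDiff_const.mul ?_)
  exact (contDiff_const.mul (Complex.ofRealCLM.contDiff.comp Complex.imCLM.contDiff)).pow k

theorem contDiff_imTaylor {φ : ℝ → ℂ} (hφ : ContDiff ℝ ∞ φ) (n : ℕ) :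
    ContDiff ℝ ∞ (imTaylor φ n) :=
  ContDiff.sum fun k _ => contDiff_imTaylorTerm hφ k

/-- For `k = 0` the truncated exponent `k - 1` does no harm, its factor `k` being zero. -/
theorem dbar_imTaylorTerm {φ : ℝ → ℂ} (hφ : ContDiff ℝ ∞ φ) (k : ℕ) (ζ : ℂ) :
    dbar (imTaylorTerm φ k) ζ 1 =
      1 / 2 * (iteratedDeriv (k + 1) φ ζ.re * ((k.factorial : ℂ)⁻¹ * (Complex.I * ζ.im) ^ k) -
        iteratedDeriv k φ ζ.re * ((k.factorial : ℂ)⁻¹ * (k * (Complex.I * ζ.im) ^ (k - 1)))) := by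
  have h₁ : HasDerivAt (iteratedDeriv k φ) (iteratedDeriv (k + 1) φ ζ.re) ζ.re := by
    rw [iteratedDeriv_succ]
    exact ((contDiff_iteratedDeriv hφ k).differentiable (by simp) _).hasDerivAt
  have h₂ := h₁.hasFDerivAt.comp ζ Complex.reCLM.hasFDerivAt
  have h₃ : HasDerivAt (fun y : ℝ => (k.factorial : ℂ)⁻¹ * (Complex.I * y) ^ k)
      ((k.factorial : ℂ)⁻¹ * (k * (Complex.I * ζ.im) ^ (k - 1) * Complex.I)) ζ.im := by
    have := (((hasDerivAt_id ζ.im).ofReal_comp.const_mul Complex.I).fun_pow k).const_mul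
      (k.factorial : ℂ)⁻¹
    simpa using this
  have h₄ := h₃.hasFDerivAt.comp ζ Complex.imCLM.hasFDerivAt
  have h₅ : HasFDerivAt (imTaylorTerm φ k) _ ζ := h₂.mul h₄
  rw [dbar_apply_one, h₅.fderiv]
  simp
  linear_combination (iteratedDeriv k φ ζ.re * (k.factorial : ℂ)⁻¹ *
    (k * (Complex.I * ζ.im) ^ (k - 1))) * Complex.I_mul_I

/-- The sum telescopes, as `(k + 1) / (k + 1)! = 1 / k!`: only the first piece of the last term
survives. -/
theorem dbar_imTaylor {φ : ℝ → ℂ} (hφ : ContDiff ℝ ∞ φ) (n : ℕ) (ζ : ℂ) :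
    dbar (imTaylor φ n) ζ 1 =
      1 / 2 * (iteratedDeriv (n + 1) φ ζ.re *
        ((n.factorial : ℂ)⁻¹ * (Complex.I * ζ.im) ^ n)) := by
  induction n with
  | zero =>
    have : imTaylor φ 0 = imTaylorTerm φ 0 := by
      ext ζ
      simp [imTaylor]
    rw [this, dbar_imTaylorTerm hφ]
    simp
  | succ n ih =>
    have e : imTaylor φ (n + 1) = imTaylor φ n + imTaylorTerm φ (n + 1) := by
      ext ζ
      rw [imTaylor, Finset.sum_range_succ]
      rfl
    have e' : dbar (imTaylor φ (n + 1)) ζ 1 =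
        dbar (imTaylor φ n) ζ 1 + dbar (imTaylorTerm φ (n + 1)) ζ 1 := by
      simp only [dbar_apply_one]
      rw [e, fderiv_add ((contDiff_imTaylor hφ n).differentiable (by simp) ζ)
        ((contDiff_imTaylorTerm hφ (n + 1)).differentiable (by simp) ζ)]
      simp only [add_apply]
      ring
    rw [e', ih, dbar_imTaylorTerm hφ, Nat.factorial_succ]
    have h1 : ((n : ℂ) + 1) ≠ 0 := Nat.cast_add_one_ne_zero n
    push_cast
    rw [mul_inv]
    field_simp
    ring

/-- A test function has compactly supported extensions to a given complex neighbourhood of its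
support, with `∂̄f` vanishing to any given finite order on the real axis. -/
theorem exists_flat_extension (φ : TestFn) (n : ℕ) {p r : ℝ} (hr : 0 < r)
    (hφ : tsupport φ ⊆ Metric.ball p (r / 2)) :
    ∃ (f : ℂ → ℂ) (C : ℝ), ContDiff ℝ 1 f ∧ HasCompactSupport f ∧ (∀ ξ : ℝ, f ξ = φ ξ) ∧
      (∀ ζ, ‖dbar f ζ 1‖ ≤ C * |ζ.im| ^ n) ∧ tsupport f ⊆ Metric.ball (p : ℂ) r := by
  -- The cutoff in `Im ζ` is `1` up to `r / 4`, leaving the Taylor polynomial intact near the axis,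
  -- and is supported in `|Im ζ| ≤ r / 2`; with `|Re ζ - p| < r / 2` this keeps `f` inside the ball
  -- of radius `r`.
  let b : ContDiffBump (0 : ℝ) := ⟨r / 4, r / 2, by positivity, by linarith⟩
  let f : ℂ → ℂ := fun ζ => (b ζ.im : ℂ) * imTaylor φ n ζ
  have hf : ContDiff ℝ 1 f := by
    refine ContDiff.mul ?_ ((contDiff_imTaylor φ.contDiff n).of_le (by exact_mod_cast le_top))
    exact Complex.ofRealCLM.contDiff.comp (b.contDiff.comp Complex.imCLM.contDiff)
  have hsupp : tsupport f ⊆ {ζ | ζ.re ∈ tsupport φ ∧ ζ.im ∈ Metric.closedBall (0 : ℝ) (r / 2)} := by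
    refine closure_minimal ?_ (((isClosed_tsupport φ).preimage Complex.continuous_re).inter
      (Metric.isClosed_closedBall.preimage Complex.continuous_im))
    intro ζ hζ
    by_contra hn
    refine hζ ?_
    by_cases h1 : ζ.re ∈ tsupport φ
    · have h2 : ζ.im ∉ tsupport b := fun h => hn ⟨h1, by rwa [b.tsupport_eq] at h⟩
      simp [f, image_eq_zero_of_notMem_tsupport h2]
    · have h2 : ∀ k, iteratedDeriv k φ ζ.re = 0 := fun k => by
        rw [← norm_eq_zero, ← norm_iteratedFDeriv_eq_norm_iteratedDeriv, norm_eq_zero]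
        exact image_eq_zero_of_notMem_tsupport fun h => h1 (tsupport_iteratedFDeriv_subset k h)
      simp [f, imTaylor, imTaylorTerm, h2]
  have hball : tsupport f ⊆ Metric.ball (p : ℂ) r := by
    intro ζ hζ
    obtain ⟨h1, h2⟩ := hsupp hζ
    have h3 := hφ h1
    rw [Metric.mem_ball, Real.dist_eq] at h3
    rw [Metric.mem_closedBall, Real.dist_eq, sub_zero] at h2
    rw [Metric.mem_ball, dist_eq_norm]
    refine (Complex.norm_le_abs_re_add_abs_im _).trans_lt ?_
    simp only [Complex.sub_re, Complex.ofReal_re, Complex.sub_im, Complex.ofReal_im, sub_zero]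
    linarith
  have hc : HasCompactSupport f :=
    (ProperSpace.isCompact_closedBall (p : ℂ) r).of_isClosed_subset (isClosed_tsupport f)
      (hball.trans Metric.ball_subset_closedBall)
  have hfar : ∃ M : ℝ, ∀ ζ, ‖dbar f ζ 1‖ ≤ M :=
    (continuous_dbar_apply_one hf).bounded_above_of_compact_support
      (HasCompactSupport.intro hc.isCompact fun _ h => dbar_eq_zero_of_notMem_tsupport h)
  obtain ⟨M, hM⟩ := hfar
  have hM0 : 0 ≤ M := (norm_nonneg _).trans (hM 0)
  -- The first summand serves `|Im ζ| < r / 4`, where `f` is the Taylor polynomial; the second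
  -- serves the rest, where `|Im ζ|` is bounded below and `∂̄f` by `M`.
  refine ⟨f, ‖jet (n + 1) φ‖ + M * (r / 4)⁻¹ ^ n, hf, hc, fun ξ => ?_, fun ζ => ?_, hball⟩
  · have h1 : b (0 : ℝ) = 1 := b.one_of_mem_closedBall (by simp; positivity)
    have h2 : imTaylor φ n ξ = φ ξ := by
      rw [imTaylor, Finset.sum_range_succ']
      simp [imTaylorTerm]
    simp [f, h1, h2]
  · rw [add_mul]
    by_cases hζ : |ζ.im| < r / 4
    · have he : f =ᶠ[nhds ζ] imTaylor φ n := by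
        have : {z : ℂ | |z.im| < r / 4} ∈ nhds ζ :=
          (isOpen_lt (by fun_prop) continuous_const).mem_nhds hζ
        filter_upwards [this] with z hz
        have hz' : b z.im = 1 := b.one_of_mem_closedBall (by
          rw [Metric.mem_closedBall, Real.dist_eq, sub_zero]
          exact le_of_lt hz)
        simp [f, hz']
      have e : dbar f ζ 1 = dbar (imTaylor φ n) ζ 1 := by
        simp only [dbar_apply_one, he.fderiv_eq]
      rw [e, dbar_imTaylor φ.contDiff]
      have h1 : ‖((n.factorial : ℂ)⁻¹)‖ ≤ 1 := by
        rw [norm_inv, Complex.norm_natCast]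
        exact inv_le_one_of_one_le₀ (by exact_mod_cast n.factorial_pos)
      have h2 := norm_iteratedDeriv_le_norm_jet le_rfl φ ζ.re (N := n + 1)
      rw [norm_mul, norm_mul, norm_mul, norm_pow, norm_mul, Complex.norm_I, one_mul,
        Complex.norm_real, Real.norm_eq_abs]
      calc _ ≤ 1 * (‖jet (n + 1) φ‖ * (1 * |ζ.im| ^ n)) := by
            gcongr
            norm_num
        _ = ‖jet (n + 1) φ‖ * |ζ.im| ^ n := by ring
        _ ≤ _ := le_add_of_nonneg_right (by positivity)
    · refine (hM ζ).trans ?_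
      have h1 : 1 ≤ (r / 4)⁻¹ ^ n * |ζ.im| ^ n := by
        rw [← mul_pow]
        refine one_le_pow₀ ?_
        rw [inv_mul_eq_div, one_le_div (by positivity)]
        exact not_lt.1 hζ
      calc M ≤ M * ((r / 4)⁻¹ ^ n * |ζ.im| ^ n) := le_mul_of_one_le_right hM0 h1
        _ = M * (r / 4)⁻¹ ^ n * |ζ.im| ^ n := by ring
        _ ≤ _ := le_add_of_nonneg_left (by positivity)

/-! ### Integrals of holomorphic functions against `∂̄f` -/

theorem continuous_smul_of_tsupport_subset {Y : Type*} [NormedAddCommGroup Y] [NormedSpace ℂ Y]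
    {u : ℂ → ℂ} {g : ℂ → Y} {V : Set ℂ} (hV : IsOpen V) (hu : Continuous u)
    (hs : tsupport u ⊆ V) (hg : ContinuousOn g V) : Continuous fun ζ => u ζ • g ζ := by
  refine continuous_iff_continuousAt.2 fun ζ => ?_
  by_cases hζ : ζ ∈ tsupport u
  · exact hu.continuousAt.smul (hg.continuousAt (hV.mem_nhds (hs hζ)))
  · refine (continuousAt_const (y := (0 : Y))).congr ?_
    filter_upwards [notMem_tsupport_iff_eventuallyEq.1 hζ] with z hz
    simp [hz]

theorem integrable_smul_of_tsupport_subset {Y : Type*} [NormedAddCommGroup Y] [NormedSpace ℂ Y]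
    {u : ℂ → ℂ} {g : ℂ → Y} {V : Set ℂ} (hV : IsOpen V) (hu : Continuous u)
    (hc : HasCompactSupport u) (hs : tsupport u ⊆ V) (hg : ContinuousOn g V) :
    Integrable fun ζ => u ζ • g ζ :=
  (continuous_smul_of_tsupport_subset hV hu hs hg).integrable_of_hasCompactSupport hc.smul_right

/-- A holomorphic function integrates to zero against `∂̄f`, for `f` compactly supported in its
domain. -/
theorem integral_dbar_smul_eq_zero {Y : Type*} [NormedAddCommGroup Y] [NormedSpace ℂ Y]
    [CompleteSpace Y] {f : ℂ → ℂ} {g : ℂ → Y} {V : Set ℂ} (hV : IsOpen V) (hf : ContDiff ℝ 1 f)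
    (hc : HasCompactSupport f) (hs : tsupport f ⊆ V) (hg : DifferentiableOn ℂ g V) :
    ∫ ζ : ℂ, dbar f ζ 1 • g ζ = 0 := by
  have hfd : Continuous (fderiv ℝ f) := hf.continuous_fderiv one_ne_zero
  have hsv : ∀ v, tsupport (fun ζ => fderiv ℝ f ζ v) ⊆ tsupport f := fun v =>
    tsupport_fderiv_apply_subset ℝ v
  have hcv : ∀ v, HasCompactSupport fun ζ => fderiv ℝ f ζ v := fun v =>
    hc.fderiv_apply ℝ v
  have hi : ∀ v, Integrable fun ζ => fderiv ℝ f ζ v • g ζ := fun v =>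
    integrable_smul_of_tsupport_subset hV (by fun_prop) (hcv v) ((hsv v).trans hs) hg.continuousOn
  have hg' : ContinuousOn (deriv g) V := (hg.deriv hV).continuousOn
  have hi' : ∀ v : ℂ, Integrable fun ζ => f ζ • (v • deriv g ζ) := fun v =>
    integrable_smul_of_tsupport_subset hV hf.continuous hc hs (hg'.const_smul v)
  -- Integration by parts in the direction `v`; holomorphy makes the derivative of `g` equal to `v •
  -- deriv g ζ`, so the directions `1` and `I` cancel through `1 + I * I = 0`.
  have key : ∀ v : ℂ, ∫ ζ : ℂ, f ζ • (v • deriv g ζ) = -∫ ζ : ℂ, fderiv ℝ f ζ v • g ζ := by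
    intro v
    exact integral_bilinear_hasFDerivAt_right_eq_neg_left_of_integrable (μ := volume)
      (f := f) (f' := fderiv ℝ f) (g := g) (v := v)
      (g' := fun ζ => ((1 : ℂ →L[ℂ] ℂ).smulRight (deriv g ζ)).restrictScalars ℝ)
      (B := ContinuousLinearMap.lsmul ℝ ℂ) (hi v) (hi' v)
      (integrable_smul_of_tsupport_subset hV hf.continuous hc hs hg.continuousOn)
      (fun ζ _ => (hf.differentiable one_ne_zero ζ).hasFDerivAt)
      (fun ζ hζ => (hg.differentiableAt (hV.mem_nhds (hs hζ))).hasDerivAt.hasFDerivAt.restrictScalars ℝ)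
  have h1 := key 1
  have hI := key Complex.I
  have e : ∀ ζ, dbar f ζ 1 • g ζ = (1 / 2 : ℂ) • (fderiv ℝ f ζ 1 • g ζ) +
      (1 / 2 * Complex.I : ℂ) • (fderiv ℝ f ζ Complex.I • g ζ) := fun ζ => by
    rw [dbar_apply_one, smul_smul, smul_smul, ← add_smul]
    ring_nf
  have i1 : Integrable fun ζ => (1 / 2 : ℂ) • (fderiv ℝ f ζ 1 • g ζ) := (hi 1).smul _
  have i2 : Integrable fun ζ => (1 / 2 * Complex.I : ℂ) • (fderiv ℝ f ζ Complex.I • g ζ) :=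
    (hi Complex.I).smul _
  simp only [e]
  rw [integral_add i1 i2, integral_smul, integral_smul,
    ← neg_eq_iff_eq_neg.2 h1, ← neg_eq_iff_eq_neg.2 hI]
  have e2 : ∀ ζ, f ζ • (Complex.I • deriv g ζ) = Complex.I • (f ζ • ((1 : ℂ) • deriv g ζ)) :=
    fun ζ => by rw [one_smul, smul_comm]
  simp only [e2]
  rw [integral_smul, smul_neg, smul_neg, smul_smul, mul_assoc, Complex.I_mul_I, ← neg_add,
    ← add_smul]
  simp

/-! ### The representation formula and the spectrum of a hyperoperator -/

section Hyperoperator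

variable {X : Type*} [NormedAddCommGroup X] [NormedSpace ℂ X] (a : Hyperoperator X)

theorem pseudoresolvent_apply_one (χ : TestFn) (ζ : ℂ) : pseudoresolvent a χ ζ 1 =
    (2 * (Real.pi : ℂ) * Complex.I)⁻¹ • a.toCLM (cauchyCutoff χ ζ) := by
  simp [pseudoresolvent]

theorem wedge_pseudoresolvent (χ : TestFn) (f : ℂ → ℂ) (ζ : ℂ) :
    wedge (pseudoresolvent a χ ζ) (dbar f ζ) 1 Complex.I =
      (-(Real.pi : ℂ)⁻¹) • (dbar f ζ 1 • a.toCLM (cauchyCutoff χ ζ)) := by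
  rw [wedge_one_I, pseudoresolvent_apply_one, smul_smul, smul_smul]
  congr 1
  have : (Real.pi : ℂ) ≠ 0 := by exact_mod_cast Real.pi_ne_zero
  field_simp [Complex.I_ne_zero]

theorem integrable_wedge_and_eq_integral [CompleteSpace X] {χ φ : TestFn}
    (hφ : tsupport φ ⊆ {ξ : ℝ | χ ξ = 1}) {f : ℂ → ℂ} (hf : IsAlmostHolomorphicExtension f φ) :
    Integrable (fun ζ : ℂ => wedge (pseudoresolvent a χ ζ) (dbar f ζ) 1 Complex.I) ∧
      a.toCLM φ = ∫ ζ : ℂ, wedge (pseudoresolvent a χ ζ) (dbar f ζ) 1 Complex.I := by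
  obtain ⟨N, hN⟩ := a.toCLM.exists_isOfOrderOn χ.hasCompactSupport.isCompact
  obtain ⟨C, hC⟩ := hf.dbar_flat (N + 1)
  have hf1 : ContDiff ℝ 1 f := hf.contDiff.of_le (by exact_mod_cast le_top)
  have hflat : ∀ ζ, ‖dbar f ζ 1‖ ≤ C * |ζ.im| ^ (N + 1) := fun ζ =>
    ((dbar f ζ).le_opNorm 1).trans (by simpa using hC ζ)
  have hi : Integrable fun ζ => dbar f ζ 1 • a.toCLM (cauchyCutoff χ ζ) :=
    hN.integrable_dbar_smul hf1 hf.hasCompactSupport hflat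
  have he := hN.integral_dbar_smul hf1 hf.hasCompactSupport hflat hf.extends_fn hφ
  simp only [wedge_pseudoresolvent]
  refine ⟨hi.fun_smul _, ?_⟩
  rw [integral_smul]
  refine Eq.symm ((congrArg _ he).trans ?_)
  have : (Real.pi : ℂ) ≠ 0 := by exact_mod_cast Real.pi_ne_zero
  rw [smul_smul, neg_mul_neg, inv_mul_cancel₀ this, one_smul]
  rfl

theorem stronglyHolomorphicAt_of_notMem_spectrum (χ : TestFn) {p : ℂ}
    (hp : p ∈ (Complex.ofReal '' a.spectrum)ᶜ) :
    StronglyHolomorphicAt (pseudoresolvent a χ) p := by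
  obtain ⟨F, hF, hF'⟩ := exists_pseudoresolvent_extension a χ
  have hcl : IsClosed (Complex.ofReal '' a.spectrum) :=
    Complex.isUniformEmbedding_ofReal.isClosedEmbedding.isClosedMap _
      Distribution.isClosed_dsupport
  refine ⟨_, hcl.isOpen_compl, hp, F, fun ζ _ hζ => hF' ζ hζ, fun v x => ?_⟩
  exact (hF.clm_apply (differentiableOn_const v)).clm_apply (differentiableOn_const x)

/-- If the form is strongly holomorphic at a real point, for a cutoff equal to `1` near that
point, then the hyperoperator vanishes near that point. -/
theorem notMem_spectrum_of_stronglyHolomorphicAt [CompleteSpace X] {χ : TestFn} {p ρ : ℝ}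
    (hρ : 0 < ρ) (hχ : ∀ ξ ∈ Metric.ball p ρ, χ ξ = 1)
    (h : StronglyHolomorphicAt (pseudoresolvent a χ) (p : ℂ)) : p ∉ a.spectrum := by
  obtain ⟨V, hV, hpV, F, hF, hFd⟩ := h
  obtain ⟨r₀, hr₀, hball⟩ := Metric.mem_nhds_iff.1 (hV.mem_nhds hpV)
  obtain ⟨N, hN⟩ := a.toCLM.exists_isOfOrderOn χ.hasCompactSupport.isCompact
  set r := min r₀ ρ with hr
  have hr0 : 0 < r := lt_min hr₀ hρ
  refine (Distribution.notMem_dsupport_iff p).2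
    ⟨Metric.ball p (r / 2), fun φ hφ => ?_, Metric.isOpen_ball,
      Metric.mem_ball_self (half_pos hr0)⟩
  -- Finite flatness suffices here because `A` has order `N` on `supp χ`; the gain is that `f` can
  -- be supported inside `V`.
  obtain ⟨f, C, hf, hc, hfφ, hflat, hsupp⟩ := exists_flat_extension φ (N + 1) hr0 hφ
  have hsV : tsupport f ⊆ V :=
    hsupp.trans ((Metric.ball_subset_ball (min_le_left _ _)).trans hball)
  have hφχ : tsupport φ ⊆ {ξ : ℝ | χ ξ = 1} := fun ξ hξ =>
    hχ ξ (Metric.ball_subset_ball (by linarith [min_le_right r₀ ρ]) (hφ hξ))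
  have hi := hN.integrable_dbar_smul hf hc hflat
  have he := hN.integral_dbar_smul hf hc hflat hfφ hφχ
  have hpi : (2 * (Real.pi : ℂ) * Complex.I) ≠ 0 := Complex.two_pi_I_ne_zero
  ext x
  -- Only `F` applied to a fixed vector is known to be holomorphic, so `A φ` is shown to vanish
  -- vector by vector.
  have h0 : ∫ ζ : ℂ, dbar f ζ 1 • F ζ 1 x = 0 :=
    integral_dbar_smul_eq_zero hV hf hc hsV (hFd 1 x)
  have hcongr : ∫ ζ : ℂ, (dbar f ζ 1 • a.toCLM (cauchyCutoff χ ζ)) x =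
      ∫ ζ : ℂ, (2 * (Real.pi : ℂ) * Complex.I) • (dbar f ζ 1 • F ζ 1 x) := by
    refine integral_congr_ae ?_
    filter_upwards [ae_im_ne_zero] with ζ hζ
    by_cases hs : ζ ∈ tsupport f
    · rw [hF ζ (hsV hs) hζ, pseudoresolvent_apply_one, smul_apply,
        smul_apply, smul_comm, smul_inv_smul₀ hpi]
    · simp [dbar_eq_zero_of_notMem_tsupport hs]
  have hx := congrArg (fun L : X →L[ℂ] X => L x) he
  have happ : (∫ ζ : ℂ, dbar f ζ 1 • a.toCLM (cauchyCutoff χ ζ)) x =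
      ∫ ζ : ℂ, (dbar f ζ 1 • a.toCLM (cauchyCutoff χ ζ)) x :=
    ContinuousLinearMap.integral_apply hi x
  have hz : (-Real.pi : ℂ) • a.toCLM φ x = 0 := by
    refine hx.symm.trans (happ.trans ?_)
    rw [hcongr, integral_smul, h0, smul_zero]
  refine (smul_eq_zero.1 hz).resolve_left ?_
  exact neg_ne_zero.2 (by exact_mod_cast Real.pi_ne_zero)

theorem exists_testFn_eq_one (p : ℝ) : ∃ χ : TestFn, ∀ ξ ∈ Metric.ball p 1, χ ξ = 1 := by
  let b : ContDiffBump p := ⟨1, 2, one_pos, one_lt_two⟩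
  refine ⟨⟨fun ξ => ((b ξ : ℝ) : ℂ), Complex.ofRealCLM.contDiff.comp b.contDiff,
    b.hasCompactSupport.comp_left (g := ((↑) : ℝ → ℂ)) Complex.ofReal_zero,
    fun _ _ => trivial⟩, fun ξ hξ => ?_⟩
  change ((b ξ : ℝ) : ℂ) = 1
  rw [b.one_of_mem_closedBall (Metric.ball_subset_closedBall hξ), Complex.ofReal_one]

end Hyperoperator

end Representation

theorem proposition6p1 {X : Type*} [NormedAddCommGroup X] [NormedSpace ℂ X] [CompleteSpace X]
    (a : Hyperoperator X) :
    -- the form is holomorphic off the real axis, in operator norm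
    (∀ χ : TestFn, DifferentiableOn ℂ (pseudoresolvent a χ) {ζ : ℂ | 0 < |ζ.im|}) ∧
    -- growth at the real axis, uniformly in the real part
    (∀ χ : TestFn, ∃ M : ℕ, ∀ T : ℝ, ∃ C : ℝ, ∀ ζ : ℂ, 0 < |ζ.im| → |ζ.im| ≤ T →
      ‖pseudoresolvent a χ ζ‖ ≤ C * (|ζ.im| ^ M)⁻¹) ∧
    -- the representation formula; the integral is absolutely convergent
    (∀ χ φ : TestFn, tsupport φ ⊆ {ξ : ℝ | χ ξ = 1} →
      ∀ f : ℂ → ℂ, IsAlmostHolomorphicExtension f φ →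
        MeasureTheory.Integrable
          (fun ζ : ℂ => wedge (pseudoresolvent a χ ζ) (dbar f ζ) 1 Complex.I) ∧
        a.toCLM φ = ∫ ζ : ℂ, wedge (pseudoresolvent a χ ζ) (dbar f ζ) 1 Complex.I) ∧
    -- holomorphic continuation to the complement of the spectrum, in operator norm
    (∀ χ : TestFn, ∃ F : ℂ → ℂ →L[ℂ] (X →L[ℂ] X),
      DifferentiableOn ℂ F (Complex.ofReal '' a.spectrum)ᶜ ∧
      ∀ ζ : ℂ, ζ.im ≠ 0 → F ζ = pseudoresolvent a χ ζ) ∧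
    -- the complement of the spectrum is exactly the set where all the forms are holomorphic
    (Complex.ofReal '' a.spectrum)ᶜ =
      {p : ℂ | ∀ χ : TestFn, StronglyHolomorphicAt (pseudoresolvent a χ) p} := by
  refine ⟨fun χ => ?_, exists_norm_pseudoresolvent_le a,
    fun χ φ hφ f hf => integrable_wedge_and_eq_integral a hφ hf,
    exists_pseudoresolvent_extension a, Set.ext fun p => ⟨fun hp χ =>
      stronglyHolomorphicAt_of_notMem_spectrum a χ hp, ?_⟩⟩
  · simpa only [abs_pos] using differentiableOn_pseudoresolvent a χ
  · rintro hp ⟨q, hq, rfl⟩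
    obtain ⟨χ, hχ⟩ := exists_testFn_eq_one q
    exact notMem_spectrum_of_stronglyHolomorphicAt a one_pos hχ (hp χ) hq
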